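/- Let $N\ge 3$ and consider the system with levels $E_1,\dots,E_N$, equally spaced ($E_{n+1}-E_n=\mu\neq 0$ for $1\le n\le N-1$), with non-degenerate ground level and two-fold degenerate excited levels: $\beta_1=1$, $\beta_n=2$ for $2\le n\le N$, orthonormal basis $|n,k\rangle$ ($1\le n\le N$, $1\le k\le\beta_n$) of a Hilbert space of dimension $2N-1$, and $$H_0=\sum_{n=1}^N\sum_{k=1}^{\beta_n}E_n|n,k\rangle\langle n,k|,\qquad H_I=\sum_{n=1}^{N-1}\sum_{k=1}^{\beta_n}\sum_{p=1}^{2}d_{nk,n+1\,p}\big(|n,k\rangle\langle n+1,p|+|n+1,p\rangle\langle n,k|\big)$$ with real constants $d_{nk,n+1\,p}$. Put $$K^2_{11,11}=d_{11,21}^2+d_{11,22}^2,\qquad K^2_{ij,ij}=\sum_{\alpha=1}^{2}d_{ij,i+1\,\alpha}^2-\sum_{\gamma=1}^{\beta_{i-1}}d_{i-1\,\gamma,ij}^2\ \ (2\le i\le N-1),\qquad K^2_{Nj,Nj}=-\sum_{\gamma=1}^{2}d_{N-1\,\gamma,Nj}^2,$$ $\nu_{ij,i+1\,k}=K^2_{i+1\,k,i+1\,k}-K^2_{ij,ij}$,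 and $$b_1=d_{11,21}d_{11,22}-d_{21,31}d_{22,31}-d_{21,32}d_{22,32},$$ $$b_i=d_{i1,i+1\,1}d_{i1,i+1\,2}+d_{i2,i+1\,1}d_{i2,i+1\,2}-d_{i+1\,1,i+2\,1}d_{i+1\,2,i+2\,1}-d_{i+1\,1,i+2\,2}d_{i+1\,2,i+2\,2}\quad(2\le i\le N-2),$$ $$b_{N-1}=d_{N-1\,1,N1}d_{N-1\,1,N2}+d_{N-1\,2,N1}d_{N-1\,2,N2}.$$ Define the real symmetric matrices $$G_1=\begin{pmatrix}\nu_{11,21}&-b_1\\-b_1&\nu_{11,22}\end{pmatrix},\qquad G_i=\begin{pmatrix}\nu_{i1,i+1\,1}&-b_i&b_{i-1}&0\\-b_i&\nu_{i1,i+1\,2}&0&b_{i-1}\\b_{i-1}&0&\nu_{i2,i+1\,1}&-b_i\\0&b_{i-1}&-b_i&\nu_{i2,i+1\,2}\end{pmatrix}\quad(2\le i\le N-1),$$ let $U_i$ be unitary matrices with $U_1G_1U_1^{-1}=\mathrm{diag}(\lambda_{11},\lambda_{12})$ and $U_iG_iU_i^{-1}=\mathrm{diag}(\lambda_{i1},\lambda_{i2},\lambda_{i3},\lambda_{i4})$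 for $2\le i\le N-1$, and put $(C_{11,21},C_{11,22})^T=U_1(d_{11,21},d_{11,22})^T$. Assume: 1. $d_{n1,n+1\,1}\,d_{n2,n+1\,2}\neq d_{n1,n+1\,2}\,d_{n2,n+1\,1}$ for $2\le n\le N-1$; 2. $\lambda_{11}\ne0$, $\lambda_{12}\neq 0$, $\lambda_{11}\ne\lambda_{12}$, $C_{11,21}\neq 0$ and $C_{11,22}\neq0$; 3. all non-zero $\lambda_{ij}$, over all $i,j$, are pairwise distinct. Then the system is completely controllable by a single field: the real Lie algebra $L_0$ generated by $iH_0$ and $iH_I$ contains $\mathfrak{su}(2N-1)$, and for every $W\in SU(2N-1)$ there are a time $T\ge0$ and a piecewise constant real field $f$ on $[0,T]$ such that the solution of $\dot U(t)=-i\,(H_0+f(t)H_I)\,U(t)$, $U(0)=1$, satisfies $U(T)=W$. For example, for every $N\ge3$, the system with $E_n=n-\tfrac12$ and $d_{ij,i+1\,k}=(N+3-i-j-k)^{1/2}$ is completely controllable in this sense. -/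

import Mathlib

open scoped Matrix

attribute [local instance 100] LieRing.ofAssociativeRing

namespace DegenerateControl

/-! ### The degenerate quantum system

Levels are numbered `1, …, N`. The ground state is non-degenerate, every excited level is two-fold
degenerate. The basis state `|n,k⟩` is the pair `(n, k)` with `1 ≤ n ≤ N`, `1 ≤ k ≤ β n`. -/

/-- Degeneracy of the `n`-th level. -/
def β (n : ℕ) : ℕ := if n = 1 then 1 else 2

/-- Labels of the basis states `|n,k⟩`. -/
def states (N : ℕ) : Finset (ℕ × ℕ) :=
  (Finset.Icc 1 N ×ˢ Finset.Icc 1 2).filter fun s => s.2 ≤ β s.1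

/-- The index type of the basis of the Hilbert space. -/
abbrev State (N : ℕ) : Type := {s : ℕ × ℕ // s ∈ states N}

/-- Operators on the Hilbert space, in the basis `|n,k⟩`. -/
abbrev Op (N : ℕ) : Type := Matrix (State N) (State N) ℂ

/-- `H₀ = ∑ₙ ∑ₖ Eₙ |n,k⟩⟨n,k|`. -/
noncomputable def H₀ (N : ℕ) (E : ℕ → ℝ) : Op N :=
  Matrix.diagonal fun s => (E s.1.1 : ℂ)

/-- `H_I = ∑ₙ ∑ₖ ∑ₚ d_{nk,n+1 p} (|n,k⟩⟨n+1,p| + |n+1,p⟩⟨n,k|)`, where the real coupling constant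
`d_{nk,n+1 p}` is `d n k p`. -/
noncomputable def H_I (N : ℕ) (d : ℕ → ℕ → ℕ → ℝ) : Op N :=
  Matrix.of fun s t =>
    if t.1.1 = s.1.1 + 1 then (d s.1.1 s.1.2 t.1.2 : ℂ)
    else if s.1.1 = t.1.1 + 1 then (d t.1.1 t.1.2 s.1.2 : ℂ)
    else 0

/-! ### Controllability -/

/-- The real Lie algebra of traceless skew-Hermitian matrices. -/
def su (ι : Type*) [Fintype ι] [DecidableEq ι] : LieSubalgebra ℝ (Matrix ι ι ℂ) where
  carrier := {A | Aᴴ = -A ∧ A.trace = 0}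
  add_mem' := by
    rintro A B ⟨hA, hA'⟩ ⟨hB, hB'⟩
    refine ⟨?_, by simp [hA', hB']⟩
    rw [Matrix.conjTranspose_add, hA, hB]
    abel
  zero_mem' := by simp
  smul_mem' := by
    rintro c A ⟨hA, hA'⟩
    refine ⟨?_, by simp [hA']⟩
    rw [Matrix.conjTranspose_smul, hA]
    simp
  lie_mem' := by
    rintro A B ⟨hA, -⟩ ⟨hB, -⟩
    refine ⟨?_, ?_⟩
    · rw [Ring.lie_def, Matrix.conjTranspose_sub, Matrix.conjTranspose_mul,
        Matrix.conjTranspose_mul, hA, hB]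
      simp
    · rw [Ring.lie_def, Matrix.trace_sub, Matrix.trace_mul_comm, sub_self]

/-- The dynamical Lie algebra `L₀`: the real Lie algebra generated by `i A` and `i B`. -/
noncomputable def L₀ {ι : Type*} [Fintype ι] [DecidableEq ι] (A B : Matrix ι ι ℂ) :
    LieSubalgebra ℝ (Matrix ι ι ℂ) :=
  LieSubalgebra.lieSpan ℝ (Matrix ι ι ℂ) {Complex.I • A, Complex.I • B}

/-- The propagator of `U' = -i (A + f(t) B) U`, `U(0) = 1`, for a piecewise constant field `f`. A
pair `(t, c)` in the list stands for a time interval of length `t` on which `f = c`; the intervals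
follow each other in the order of the list. -/
noncomputable def propagator {ι : Type*} [Fintype ι] [DecidableEq ι] (A B : Matrix ι ι ℂ) :
    List (ℝ × ℝ) → Matrix ι ι ℂ
  | [] => 1
  | p :: l => propagator A B l *
      NormedSpace.exp ((-(Complex.I * (p.1 : ℂ))) • (A + (p.2 : ℂ) • B))

/-- Complete controllability of the system `A + f(t) B` by a single real field: every special
unitary operator is the propagator of some control field after some finite time. (Unitary
operators that differ by a phase are physically the same, and the special unitary group acts
transitively on the unit vectors, so every state can be steered to every other.) -/
def CompletelyControllable {ι : Type*} [Fintype ι] [DecidableEq ι] (A B : Matrix ι ι ℂ) : Prop :=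
  ∀ U ∈ Matrix.specialUnitaryGroup ι ℂ,
    ∃ l : List (ℝ × ℝ), (∀ p ∈ l, 0 ≤ p.1) ∧ propagator A B l = U

/-! ### The recursion matrices -/

/-- The parameter `K²_{ij,ij}`. -/
noncomputable def Ksq (N : ℕ) (d : ℕ → ℕ → ℕ → ℝ) (i j : ℕ) : ℝ :=
  if i = 1 then d 1 1 1 ^ 2 + d 1 1 2 ^ 2
  else if i = N then -(d (N - 1) 1 j ^ 2 + d (N - 1) 2 j ^ 2)
  else ∑ a ∈ Finset.Icc 1 (β (i + 1)), d i j a ^ 2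
    - ∑ c ∈ Finset.Icc 1 (β (i - 1)), d (i - 1) c j ^ 2

/-- The parameter `ν_{ij,i+1 k}`. -/
noncomputable def ν (N : ℕ) (d : ℕ → ℕ → ℕ → ℝ) (i j k : ℕ) : ℝ :=
  Ksq N d (i + 1) k - Ksq N d i j

/-- The parameter `b_i`, `1 ≤ i ≤ N - 1`. -/
noncomputable def b (N : ℕ) (d : ℕ → ℕ → ℕ → ℝ) (i : ℕ) : ℝ :=
  if i = 1 then d 1 1 1 * d 1 1 2 - d 2 1 1 * d 2 2 1 - d 2 1 2 * d 2 2 2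
  else if i = N - 1 then d i 1 1 * d i 1 2 + d i 2 1 * d i 2 2
  else d i 1 1 * d i 1 2 + d i 2 1 * d i 2 2
    - d (i + 1) 1 1 * d (i + 1) 2 1 - d (i + 1) 1 2 * d (i + 1) 2 2

/-- The recursion matrix `G₁`, in the order `(11,21), (11,22)`. -/
noncomputable def G₁ (N : ℕ) (d : ℕ → ℕ → ℕ → ℝ) : Matrix (Fin 2) (Fin 2) ℝ :=
  !![ν N d 1 1 1, -b N d 1;
     -b N d 1, ν N d 1 1 2]

/-- The recursion matrix `G_i`, `2 ≤ i ≤ N - 1`, in the order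
`(i1,i+1 1), (i1,i+1 2), (i2,i+1 1), (i2,i+1 2)`. -/
noncomputable def G (N : ℕ) (d : ℕ → ℕ → ℕ → ℝ) (i : ℕ) : Matrix (Fin 4) (Fin 4) ℝ :=
  !![ν N d i 1 1, -b N d i, b N d (i - 1), 0;
     -b N d i, ν N d i 1 2, 0, b N d (i - 1);
     b N d (i - 1), 0, ν N d i 2 1, -b N d i;
     0, b N d (i - 1), -b N d i, ν N d i 2 2]

/-- `U M U⁻¹ = diag(v)` with `U` unitary. -/
def Diagonalizes {m : ℕ} (U : Matrix (Fin m) (Fin m) ℂ) (M : Matrix (Fin m) (Fin m) ℝ)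
    (v : Fin m → ℝ) : Prop :=
  U ∈ Matrix.unitaryGroup (Fin m) ℂ ∧
    U * M.map (fun x : ℝ => (x : ℂ)) * U⁻¹ = Matrix.diagonal fun k => (v k : ℂ)

/-- The transformed couplings `(C_{11,21}, C_{11,22}) = U₁ (d_{11,21}, d_{11,22})`. -/
noncomputable def C₁ (U₁ : Matrix (Fin 2) (Fin 2) ℂ) (d : ℕ → ℕ → ℕ → ℝ) : Fin 2 → ℂ :=
  U₁ *ᵥ ![(d 1 1 1 : ℂ), (d 1 1 2 : ℂ)]

end DegenerateControl

/-! Write `H_I = X + Xᵀ` with `X` the real raising part. The proof has two independent halves.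

Algebra. The real matrices `R` with `R - Rᵀ` and `i (R + Rᵀ)` in `L₀` form a transpose-closed Lie
algebra `M` (`realForm`), and equal spacing puts `X` itself in `M`. The operator `K = [X, Xᵀ]`
preserves the levels, so `-ad K` maps raising operators to raising operators and acts on the
couplings between levels `i` and `i + 1` through `G_i`. Let `Q` be the product of the characteristic
polynomials of the `G_i` with `i ≥ 2`. By Cayley–Hamilton, `Q(-ad K) X` has couplings only between
levels 1 and 2. They do not all vanish: some eigenvalue of `G₁` is not a root of `Q`, and the vector
`d` of these couplings is cyclic for `G₁`. One nonzero operator `|1,1⟩⟨v|` in `M` yields `|1,1⟩⟨d|`,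
then `|1,1⟩⟨G₁ d|`, hence all matrix units on levels 1 and 2 (`containsUnits_two`). The invertible
coupling blocks carry the units up one level at a time (`ContainsUnits.succ_of_det_ne_zero`), and
the off-diagonal units generate all traceless matrices.

Control. Suppose `su ≤ L₀`. A switching sequence whose velocities span a space of maximal dimension
has `L₀` in that span, so its propagator is interior to the reachable set, relative to the ambient
group. Time cannot be reversed, but in a compact group the inverse of a propagator is a limit of its
powers; this moves the open set to the identity. Every special unitary matrix is a power of one
close to the identity.

The explicit example is not diagonalized: quadratic form bounds place the smaller eigenvalue of `G₁`
strictly below the spectra of all the other `G_i`. -/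

namespace DegenerateControl

/-! ### Propagators, exponentials and logarithms of unitary matrices. -/

section Propagators

open Matrix Filter Topology

variable {ι : Type*} [Fintype ι] [DecidableEq ι]

/-- The generator of the evolution under the constant field `c`. -/
noncomputable def generator {κ : Type*} (A B : Matrix κ κ ℂ) (c : ℝ) : Matrix κ κ ℂ :=
  (-Complex.I) • (A + (c : ℂ) • B)

theorem propagator_cons (A B : Matrix ι ι ℂ) (p : ℝ × ℝ) (l : List (ℝ × ℝ)) :
    propagator A B (p :: l) =
      propagator A B l * NormedSpace.exp (p.1 • generator A B p.2) := by
  rw [propagator, generator]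
  congr 2
  rw [← Complex.coe_smul, smul_smul]
  congr 1
  ring

theorem propagator_append (A B : Matrix ι ι ℂ) (l l' : List (ℝ × ℝ)) :
    propagator A B (l ++ l') = propagator A B l' * propagator A B l := by
  induction l with
  | nil => simp [propagator]
  | cons p l ih => rw [List.cons_append, propagator_cons, propagator_cons, ih, mul_assoc]

theorem conjTranspose_generator {κ : Type*} {A B : Matrix κ κ ℂ} (hA : A.IsHermitian) (hB : B.IsHermitian)
    (c : ℝ) : (generator A B c)ᴴ = -generator A B c := by
  simp [generator, hA.eq, hB.eq, add_comm]

theorem exp_mem_unitaryGroup {Y : Matrix ι ι ℂ} (hY : Yᴴ = -Y) :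
    NormedSpace.exp Y ∈ unitaryGroup ι ℂ := by
  rw [mem_unitaryGroup_iff', star_eq_conjTranspose, ← exp_conjTranspose, hY,
    ← exp_add_of_commute _ _ (Commute.neg_left (Commute.refl Y)), neg_add_cancel,
    NormedSpace.exp_zero]

theorem conjTranspose_exp {Y : Matrix ι ι ℂ} (hY : Yᴴ = -Y) :
    (NormedSpace.exp Y)ᴴ = NormedSpace.exp (-Y) := by
  rw [← exp_conjTranspose, hY]

theorem conjTranspose_real_smul_skew {κ : Type*} {Y : Matrix κ κ ℂ} (hY : Yᴴ = -Y) (t : ℝ) :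
    (t • Y)ᴴ = -(t • Y) := by
  simp [conjTranspose_smul, hY]

theorem propagator_mem_unitaryGroup {A B : Matrix ι ι ℂ} (hA : A.IsHermitian)
    (hB : B.IsHermitian) (l : List (ℝ × ℝ)) : propagator A B l ∈ unitaryGroup ι ℂ := by
  induction l with
  | nil => exact one_mem _
  | cons p l ih =>
    rw [propagator_cons]
    exact mul_mem ih (exp_mem_unitaryGroup
      (conjTranspose_real_smul_skew (conjTranspose_generator hA hB _) _))

theorem exp_conj_unitary {V : Matrix ι ι ℂ} (hV : V ∈ unitaryGroup ι ℂ) (Y : Matrix ι ι ℂ) :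
    NormedSpace.exp (V * Y * Vᴴ) = V * NormedSpace.exp Y * Vᴴ := by
  have h1 : V * Vᴴ = 1 := mem_unitaryGroup_iff.1 hV
  have h2 : V⁻¹ = Vᴴ := inv_eq_right_inv h1
  have := exp_conj V Y (IsUnit.of_mul_eq_one _ h1)
  rwa [h2] at this

theorem IsHermitian.eq_conj_diagonal {H : Matrix ι ι ℂ} (hH : H.IsHermitian) :
    ∃ V ∈ unitaryGroup ι ℂ, ∃ θ : ι → ℝ, H = V * diagonal (fun k => (θ k : ℂ)) * Vᴴ := by
  refine ⟨hH.eigenvectorUnitary, hH.eigenvectorUnitary.2, hH.eigenvalues, ?_⟩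
  conv_lhs => rw [hH.spectral_theorem]
  rw [Unitary.conjStarAlgAut_apply]
  rfl

theorem exp_I_smul_conj_diagonal {V : Matrix ι ι ℂ} (hV : V ∈ unitaryGroup ι ℂ) (θ : ι → ℝ) :
    NormedSpace.exp (Complex.I • (V * diagonal (fun k => (θ k : ℂ)) * Vᴴ)) =
      V * diagonal (fun k => Complex.exp (Complex.I * θ k)) * Vᴴ := by
  rw [← smul_mul_assoc, ← mul_smul_comm, exp_conj_unitary hV, ← diagonal_smul, exp_diagonal]
  congr 3
  funext k
  simp [Pi.coe_exp, Complex.exp_eq_exp_ℂ]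

theorem det_conj_unitary {V : Matrix ι ι ℂ} (hV : V ∈ unitaryGroup ι ℂ) (Y : Matrix ι ι ℂ) :
    (V * Y * Vᴴ).det = Y.det := by
  have h1 : V * Vᴴ = 1 := mem_unitaryGroup_iff.1 hV
  have h2 : V.det * Vᴴ.det = 1 := by rw [← det_mul, h1, det_one]
  rw [det_mul, det_mul, mul_right_comm, h2, one_mul]

theorem trace_conj_unitary {V : Matrix ι ι ℂ} (hV : V ∈ unitaryGroup ι ℂ) (Y : Matrix ι ι ℂ) :
    (V * Y * Vᴴ).trace = Y.trace := by
  have h1 : Vᴴ * V = 1 := mem_unitaryGroup_iff'.1 hV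
  rw [trace_mul_cycle, h1, one_mul]

theorem det_exp_I_smul {H : Matrix ι ι ℂ} (hH : H.IsHermitian) :
    (NormedSpace.exp (Complex.I • H)).det = Complex.exp (Complex.I * H.trace) := by
  obtain ⟨V, hV, θ, rfl⟩ := IsHermitian.eq_conj_diagonal hH
  rw [exp_I_smul_conj_diagonal hV, det_conj_unitary hV, trace_conj_unitary hV, det_diagonal,
    trace_diagonal, Finset.mul_sum, Complex.exp_sum]

theorem det_exp_skew {Y : Matrix ι ι ℂ} (hY : Yᴴ = -Y) :
    (NormedSpace.exp Y).det = Complex.exp Y.trace := by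
  have h : (-(Complex.I • Y)).IsHermitian := by
    simp [IsHermitian, hY]
  have := det_exp_I_smul h
  simpa [smul_smul, ← mul_assoc] using this

section UnitaryLog

open scoped Matrix.Norms.L2Operator

/-- The argument function is applied to `W` by functional calculus. Its jump on the negative axis is
harmless, because the spectrum is finite and every function is continuous on it. -/
theorem exists_isHermitian_exp_I_smul_eq {W : Matrix ι ι ℂ} (hW : W ∈ unitaryGroup ι ℂ) :
    ∃ H : Matrix ι ι ℂ, H.IsHermitian ∧ NormedSpace.exp (Complex.I • H) = W := by
  have hn : IsStarNormal W := by
    constructor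
    rw [Commute, SemiconjBy, mem_unitaryGroup_iff.1 hW, mem_unitaryGroup_iff'.1 hW]
  have hc (f : ℂ → ℂ) : ContinuousOn f (spectrum ℂ W) := (W.finite_spectrum).continuousOn f
  have hs : ∀ z ∈ spectrum ℂ W, ‖z‖ = 1 := fun z hz => by
    simpa using spectrum.subset_circle_of_unitary hW hz
  set f : ℂ → ℂ := fun z => ((z.arg : ℝ) : ℂ) with hf
  refine ⟨cfc f W, ?_, ?_⟩
  · have : IsSelfAdjoint (cfc f W) := by
      rw [IsSelfAdjoint, ← cfc_star]
      congr 1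
      funext z
      simp [hf]
    exact this
  · rw [← cfc_smul Complex.I f W (hc _), ← CFC.complex_exp_eq_normedSpace_exp
      (p := IsStarNormal) (cfc_predicate _ _), ← cfc_comp' _ _ W (by fun_prop) (hc _)]
    conv_rhs => rw [← cfc_id ℂ W]
    refine cfc_congr fun z hz => ?_
    have := Complex.norm_mul_exp_arg_mul_I z
    rw [hs z hz] at this
    simpa [hf, mul_comm] using this

end UnitaryLog

theorem exists_su_exp_eq [Nonempty ι] {W : Matrix ι ι ℂ} (hW : W ∈ specialUnitaryGroup ι ℂ) :
    ∃ Y ∈ su ι, NormedSpace.exp Y = W := by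
  obtain ⟨hU, hd⟩ := mem_specialUnitaryGroup_iff.1 hW
  obtain ⟨H, hH, rfl⟩ := exists_isHermitian_exp_I_smul_eq hU
  obtain ⟨V, hV, θ, rfl⟩ := IsHermitian.eq_conj_diagonal hH
  rw [det_exp_I_smul hH, trace_conj_unitary hV, trace_diagonal, Complex.exp_eq_one_iff] at hd
  obtain ⟨k, hk⟩ := hd
  have hk' : ∑ i, θ i = k * (2 * Real.pi) := by
    have : (∑ i, (θ i : ℂ)) = k * (2 * Real.pi) := by
      apply mul_left_cancel₀ Complex.I_ne_zero
      rw [hk]; ring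
    exact_mod_cast this
  -- Determinant one only makes the sum of the phases a multiple of 2π. The whole excess is removed
  -- from one eigenvalue, which does not change the exponential.
  let i₀ : ι := Classical.arbitrary ι
  let θ' : ι → ℝ := fun i => θ i - if i = i₀ then k * (2 * Real.pi) else 0
  refine ⟨Complex.I • (V * diagonal (fun k => (θ' k : ℂ)) * Vᴴ), ⟨?_, ?_⟩, ?_⟩
  · simp only [conjTranspose_smul, conjTranspose_mul, conjTranspose_conjTranspose,
      diagonal_conjTranspose, mul_assoc]
    rw [show star (fun k => (θ' k : ℂ)) = fun k => (θ' k : ℂ) by funext; simp]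
    simp
  · rw [trace_smul, trace_conj_unitary hV, trace_diagonal]
    have : ∑ i, θ' i = 0 := by simp [θ', Finset.sum_sub_distrib, hk']
    rw [show (∑ i, (θ' i : ℂ)) = 0 by exact_mod_cast this, smul_zero]
  · rw [exp_I_smul_conj_diagonal hV, exp_I_smul_conj_diagonal hV]
    congr 3
    funext i
    simp only [θ']
    split_ifs with h
    · rw [Complex.exp_eq_exp_iff_exists_int]
      exact ⟨-k, by push_cast; ring⟩
    · simp

end Propagators

/-! ### Velocities of propagators span the dynamical Lie algebra. -/

section TangentSpace

open Matrix Filter Topology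

variable {ι : Type*} [Fintype ι] [DecidableEq ι]

/-- The span of the velocities, translated to the identity, of the propagator of a control field
when the durations of its pieces vary. -/
noncomputable def tangentSpan (A B : Matrix ι ι ℂ) : List (ℝ × ℝ) → Submodule ℝ (Matrix ι ι ℂ)
  | [] => ⊥
  | p :: l => tangentSpan A B l ⊔
      Submodule.span ℝ {propagator A B l * generator A B p.2 * (propagator A B l)ᴴ}

/-- The span of the generators conjugated by the propagators of positive durations. -/
noncomputable def orbitSpan (A B : Matrix ι ι ℂ) : Submodule ℝ (Matrix ι ι ℂ) :=
  Submodule.span ℝ {Z | ∃ (l : List (ℝ × ℝ)) (c : ℝ), (∀ p ∈ l, 0 < p.1) ∧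
    Z = propagator A B l * generator A B c * (propagator A B l)ᴴ}

theorem tangentSpan_le_append (A B : Matrix ι ι ℂ) (l' l : List (ℝ × ℝ)) :
    tangentSpan A B l ≤ tangentSpan A B (l' ++ l) := by
  induction l' with
  | nil => exact le_rfl
  | cons p l' ih => exact ih.trans le_sup_left

/-- Conjugation `Z ↦ V Z V†`, as a real linear map. -/
def conjLinear (V : Matrix ι ι ℂ) : Matrix ι ι ℂ →ₗ[ℝ] Matrix ι ι ℂ where
  toFun Z := V * Z * Vᴴ
  map_add' Z Z' := by rw [mul_add, add_mul]
  map_smul' r Z := by simp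

theorem conjLinear_apply (V Z : Matrix ι ι ℂ) : conjLinear V Z = V * Z * Vᴴ := rfl

theorem conjLinear_injective {V : Matrix ι ι ℂ} (hV : V ∈ unitaryGroup ι ℂ) :
    Function.Injective (conjLinear V) := by
  have h1 : Vᴴ * V = 1 := mem_unitaryGroup_iff'.1 hV
  intro Z Z' h
  have := congrArg (fun M => Vᴴ * M * V) h
  simp only [conjLinear_apply, mul_assoc, h1, mul_one] at this
  simpa only [← mul_assoc, h1, one_mul] using this

/-- Concatenating control sequences gives the inclusion of the image. Conjugation is injective and
the dimension finite, so equality follows although the inverse of a propagator need not be a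
propagator. -/
theorem map_conjLinear_orbitSpan {A B : Matrix ι ι ℂ} (hA : A.IsHermitian) (hB : B.IsHermitian)
    {l : List (ℝ × ℝ)} (hl : ∀ p ∈ l, 0 < p.1) :
    (orbitSpan A B).map (conjLinear (propagator A B l)) = orbitSpan A B := by
  have hinj := conjLinear_injective (propagator_mem_unitaryGroup hA hB l)
  refine Submodule.eq_of_le_of_finrank_eq ?_
    (Submodule.equivMapOfInjective _ hinj _).finrank_eq.symm
  rw [orbitSpan, Submodule.map_span_le]
  rintro _ ⟨l', c, hl', rfl⟩
  refine Submodule.subset_span ⟨l' ++ l, c, ?_, ?_⟩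
  · intro p hp
    rcases List.mem_append.1 hp with h | h
    exacts [hl' p h, hl p h]
  · rw [propagator_append, conjLinear_apply, conjTranspose_mul]
    simp only [mul_assoc]

/-- Take `l` with `tangentSpan` of maximal dimension. Prefixing further pieces cannot enlarge the
span, so it already contains every spanning vector of `orbitSpan` conjugated by the propagator of
`l`; these conjugates span `orbitSpan` again. -/
theorem exists_orbitSpan_le_tangentSpan {A B : Matrix ι ι ℂ} (hA : A.IsHermitian)
    (hB : B.IsHermitian) :
    ∃ l : List (ℝ × ℝ), (∀ p ∈ l, 0 < p.1) ∧ orbitSpan A B ≤ tangentSpan A B l := by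
  let R : Set ℕ := {k | ∃ l : List (ℝ × ℝ), (∀ p ∈ l, 0 < p.1) ∧
    Module.finrank ℝ (tangentSpan A B l) = k}
  have hR : R.Nonempty := ⟨_, [], by simp, rfl⟩
  have hb : BddAbove R := by
    refine ⟨Module.finrank ℝ (Matrix ι ι ℂ), ?_⟩
    rintro _ ⟨l, -, rfl⟩
    exact Submodule.finrank_le _
  obtain ⟨l, hl, hk⟩ := Nat.sSup_mem hR hb
  have hmax : ∀ l' : List (ℝ × ℝ), (∀ p ∈ l', 0 < p.1) →
      Module.finrank ℝ (tangentSpan A B l') ≤ Module.finrank ℝ (tangentSpan A B l) := by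
    intro l' hl'
    rw [hk]
    exact le_csSup hb ⟨l', hl', rfl⟩
  refine ⟨l, hl, ?_⟩
  rw [← map_conjLinear_orbitSpan hA hB hl, orbitSpan, Submodule.map_span_le]
  rintro _ ⟨l', c, hl', rfl⟩
  -- The duration 1 is arbitrary: the velocity of a piece is conjugated only by the pieces that
  -- follow it.
  have hle : tangentSpan A B l ≤ tangentSpan A B (((1, c) :: l') ++ l) :=
    tangentSpan_le_append A B _ l
  have heq := Submodule.eq_of_le_of_finrank_le hle (hmax _ (by
    intro p hp
    simp only [List.cons_append, List.mem_cons, List.mem_append] at hp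
    rcases hp with rfl | h | h
    exacts [one_pos, hl' p h, hl p h]))
  rw [heq, List.cons_append, tangentSpan]
  refine Submodule.mem_sup_right (Submodule.subset_span ?_)
  rw [Set.mem_singleton_iff, propagator_append, conjLinear_apply, conjTranspose_mul]
  simp only [mul_assoc]

section Calculus

attribute [local instance] Matrix.linftyOpNormedRing Matrix.linftyOpNormedAlgebra

theorem hasDerivAt_exp_conj (Y Z : Matrix ι ι ℂ) :
    HasDerivAt (fun t : ℝ => NormedSpace.exp (t • Y) * Z * NormedSpace.exp (t • (-Y)))
      (Y * Z - Z * Y) 0 := by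
  have h1 := hasDerivAt_exp_smul_const (𝕂 := ℝ) Y 0
  have h2 := hasDerivAt_exp_smul_const (𝕂 := ℝ) (-Y) 0
  have := (h1.mul_const Z).mul h2
  have h3 : NormedSpace.exp ((0 : ℝ) • Y) * Y * Z * NormedSpace.exp ((0 : ℝ) • (-Y)) +
      NormedSpace.exp ((0 : ℝ) • Y) * Z * (NormedSpace.exp ((0 : ℝ) • (-Y)) * (-Y)) =
      Y * Z - Z * Y := by simp [sub_eq_add_neg]
  exact this.congr_deriv h3

/-- The bracket is the derivative of the conjugation at time 0. The right-hand derivative suffices,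
so only positive times are needed, and a finite-dimensional subspace is closed. -/
theorem lie_mem_of_exp_conj_mem {W : Submodule ℝ (Matrix ι ι ℂ)} {Y : Matrix ι ι ℂ}
    (hY : Yᴴ = -Y)
    (h : ∀ t : ℝ, 0 < t → ∀ Z ∈ W, NormedSpace.exp (t • Y) * Z * (NormedSpace.exp (t • Y))ᴴ ∈ W)
    {Z : Matrix ι ι ℂ} (hZ : Z ∈ W) : ⁅Y, Z⁆ ∈ W := by
  have hc : IsClosed (W : Set (Matrix ι ι ℂ)) := W.closed_of_finiteDimensional
  have hd := (hasDerivAt_exp_conj Y Z).hasDerivWithinAt (s := Set.Ioi 0)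
  rw [hasDerivWithinAt_iff_tendsto_slope' (by simp)] at hd
  rw [Ring.lie_def]
  refine hc.mem_of_tendsto hd ?_
  filter_upwards [self_mem_nhdsWithin] with t ht
  rw [slope_def_module]
  refine W.smul_mem _ (W.sub_mem ?_ ?_)
  · have := h t ht Z hZ
    rwa [conjTranspose_exp (conjTranspose_real_smul_skew hY t), ← smul_neg] at this
  · simpa using hZ

end Calculus

theorem lie_generator_mem_orbitSpan {A B : Matrix ι ι ℂ} (hA : A.IsHermitian)
    (hB : B.IsHermitian) (c : ℝ) {Z : Matrix ι ι ℂ} (hZ : Z ∈ orbitSpan A B) :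
    ⁅generator A B c, Z⁆ ∈ orbitSpan A B := by
  refine lie_mem_of_exp_conj_mem (conjTranspose_generator hA hB c) (fun t ht Z hZ => ?_) hZ
  have hl : ∀ p ∈ [(t, c)], 0 < p.1 := by simpa using ht
  have := Submodule.mem_map_of_mem (f := conjLinear (propagator A B [(t, c)])) hZ
  rw [map_conjLinear_orbitSpan hA hB hl] at this
  rwa [conjLinear_apply, propagator_cons, propagator, one_mul] at this

theorem L₀_le_orbitSpan {A B : Matrix ι ι ℂ} (hA : A.IsHermitian) (hB : B.IsHermitian)
    {Z : Matrix ι ι ℂ} (hZ : Z ∈ L₀ A B) : Z ∈ orbitSpan A B := by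
  have hgen (c : ℝ) : generator A B c ∈ orbitSpan A B :=
    Submodule.subset_span ⟨[], c, by simp, by simp [propagator]⟩
  have hA' : Complex.I • A = -generator A B 0 := by simp [generator]
  have hB' : Complex.I • B = generator A B 0 - generator A B 1 := by
    simp [generator]
  -- `orbitSpan` is not known to be a Lie algebra. The induction therefore also carries that `ad Z`
  -- preserves it, and the Jacobi identity handles brackets.
  suffices h : Z ∈ orbitSpan A B ∧ ∀ T ∈ orbitSpan A B, ⁅Z, T⁆ ∈ orbitSpan A B from h.1
  induction hZ using LieSubalgebra.lieSpan_induction with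
  | mem x hx =>
    rcases hx with rfl | hx
    · rw [hA']
      refine ⟨neg_mem (hgen 0), fun T hT => ?_⟩
      rw [neg_lie]
      exact neg_mem (lie_generator_mem_orbitSpan hA hB 0 hT)
    · rw [Set.mem_singleton_iff.1 hx, hB']
      refine ⟨sub_mem (hgen 0) (hgen 1), fun T hT => ?_⟩
      rw [sub_lie]
      exact sub_mem (lie_generator_mem_orbitSpan hA hB 0 hT)
        (lie_generator_mem_orbitSpan hA hB 1 hT)
  | zero => exact ⟨zero_mem _, fun T _ => by simp⟩
  | add x y _ _ hx hy =>
    refine ⟨add_mem hx.1 hy.1, fun T hT => ?_⟩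
    rw [add_lie]
    exact add_mem (hx.2 T hT) (hy.2 T hT)
  | smul a x _ hx =>
    refine ⟨Submodule.smul_mem _ _ hx.1, fun T hT => ?_⟩
    rw [smul_lie]
    exact Submodule.smul_mem _ _ (hx.2 T hT)
  | lie x y _ _ hx hy =>
    refine ⟨hx.2 y hy.1, fun T hT => ?_⟩
    rw [lie_lie]
    exact sub_mem (hx.2 _ (hy.2 T hT)) (hy.2 _ (hx.2 T hT))

end TangentSpace

/-! ### From the Lie algebra to reachability of the whole group. -/

section Reachability

open Matrix Filter Topology

variable {ι : Type*} [Fintype ι] [DecidableEq ι]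

section Calculus

attribute [local instance] Matrix.linftyOpNormedRing Matrix.linftyOpNormedAlgebra

theorem HasStrictFDerivAt.exists_mul {E : Type*} [NormedAddCommGroup E] [NormedSpace ℝ E]
    {f g : E → Matrix ι ι ℂ} {f' g' : E →L[ℝ] Matrix ι ι ℂ} {x : E}
    (hf : HasStrictFDerivAt f f' x) (hg : HasStrictFDerivAt g g' x) :
    ∃ h' : E →L[ℝ] Matrix ι ι ℂ, HasStrictFDerivAt (fun z => f z * g z) h' x ∧
      ∀ v, h' v = f x * g' v + f' v * g x :=
  ⟨_, hf.mul' hg, fun _ => rfl⟩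

theorem hasStrictFDerivAt_exp_add_smul (Y : Matrix ι ι ℂ) (t : ℝ) :
    HasStrictFDerivAt (fun u : ℝ => NormedSpace.exp ((t + u) • Y))
      (ContinuousLinearMap.smulRight (1 : ℝ →L[ℝ] ℝ) (Y * NormedSpace.exp (t • Y))) 0 := by
  have h1 := (hasStrictDerivAt_exp_smul_const' (𝕂 := ℝ) Y (t + 0)).hasStrictFDerivAt
  have h2 := HasStrictFDerivAt.comp (x := (0 : ℝ)) (f := fun u : ℝ => t + u) h1
    ((hasStrictFDerivAt_id (0 : ℝ)).const_add t)
  rw [add_zero] at h2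
  exact h2

/-- The parameters are changes of the durations of the pieces, with one extra dummy coordinate from
the empty list. Durations are strictly positive so that small changes in either direction remain
admissible. -/
theorem exists_parametrization {A B : Matrix ι ι ℂ} (hA : A.IsHermitian) (hB : B.IsHermitian)
    (l : List (ℝ × ℝ)) (hl : ∀ p ∈ l, 0 < p.1) :
    ∃ (E : Type) (_ : NormedAddCommGroup E) (_ : NormedSpace ℝ E) (_ : CompleteSpace E)
      (f : E → Matrix ι ι ℂ) (f' : E →L[ℝ] Matrix ι ι ℂ), f 0 = propagator A B l ∧
      HasStrictFDerivAt f f' 0 ∧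
      (∀ Z ∈ tangentSpan A B l, ∃ x, f' x = Z * propagator A B l) ∧
      ∀ᶠ x in 𝓝 (0 : E), ∃ l' : List (ℝ × ℝ), (∀ p ∈ l', 0 < p.1) ∧ propagator A B l' = f x := by
  induction l with
  | nil =>
    refine ⟨ℝ, inferInstance, inferInstance, inferInstance, fun _ => 1, 0, rfl,
      hasStrictFDerivAt_const _ _, fun Z hZ => ⟨0, ?_⟩, .of_forall fun _ => ⟨[], by simp, rfl⟩⟩
    rw [tangentSpan, Submodule.mem_bot] at hZ
    simp [hZ]
  | cons p l ih =>
    obtain ⟨E, _, _, _, f, f', hf0, hf', hr, hE⟩ := ih fun q hq => hl q (List.mem_cons_of_mem _ hq)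
    set Y := generator A B p.2 with hY
    have hfst : HasStrictFDerivAt (fun z : E × ℝ => f z.1)
        (f'.comp (ContinuousLinearMap.fst ℝ E ℝ)) 0 :=
      HasStrictFDerivAt.comp (x := (0 : E × ℝ)) (g := f) (f := Prod.fst) hf'
        hasStrictFDerivAt_fst
    have hsnd : HasStrictFDerivAt (fun z : E × ℝ => NormedSpace.exp ((p.1 + z.2) • Y))
        ((ContinuousLinearMap.smulRight (1 : ℝ →L[ℝ] ℝ)
          (Y * NormedSpace.exp (p.1 • Y))).comp (ContinuousLinearMap.snd ℝ E ℝ)) 0 :=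
      HasStrictFDerivAt.comp (x := (0 : E × ℝ)) (f := Prod.snd)
        (g := fun t : ℝ => NormedSpace.exp ((p.1 + t) • Y))
        (hasStrictFDerivAt_exp_add_smul Y p.1) hasStrictFDerivAt_snd
    obtain ⟨h', hh', hv⟩ := HasStrictFDerivAt.exists_mul hfst hsnd
    refine ⟨E × ℝ, inferInstance, inferInstance, inferInstance,
      fun z => f z.1 * NormedSpace.exp ((p.1 + z.2) • Y), h', ?_, hh', ?_, ?_⟩
    · simp [hf0, propagator_cons, hY]
    · intro Z hZ
      rw [tangentSpan, Submodule.mem_sup] at hZ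
      obtain ⟨Z₁, hZ₁, Z₂, hZ₂, rfl⟩ := hZ
      obtain ⟨r, rfl⟩ := Submodule.mem_span_singleton.1 hZ₂
      obtain ⟨x, hx⟩ := hr Z₁ hZ₁
      have hU : (propagator A B l)ᴴ * propagator A B l = 1 :=
        mem_unitaryGroup_iff'.1 (propagator_mem_unitaryGroup hA hB l)
      refine ⟨(x, r), ?_⟩
      have h : propagator A B l * (r • (Y * NormedSpace.exp (p.1 • Y))) +
          (Z₁ * propagator A B l) * NormedSpace.exp (p.1 • Y) =
          (Z₁ + r • (propagator A B l * Y * (propagator A B l)ᴴ)) *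
            (propagator A B l * NormedSpace.exp (p.1 • Y)) := by
        rw [add_mul, smul_mul_assoc, mul_smul_comm, add_comm]
        congr 1
        · simp only [mul_assoc]
        · rw [mul_assoc _ (propagator A B l)ᴴ, ← mul_assoc (propagator A B l)ᴴ, hU, one_mul,
            mul_assoc]
      rw [hv, propagator_cons, ← hY, ← h, ← hx, ← hf0]
      simp
    · have h1 : ∀ᶠ z : E × ℝ in 𝓝 0, ∃ l' : List (ℝ × ℝ), (∀ p ∈ l', 0 < p.1) ∧
          propagator A B l' = f z.1 := (continuous_fst.tendsto (0 : E × ℝ)).eventually hE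
      have h2 : ∀ᶠ z : E × ℝ in 𝓝 0, 0 < p.1 + z.2 := by
        have : Tendsto (fun z : E × ℝ => p.1 + z.2) (𝓝 0) (𝓝 (p.1 + 0)) :=
          (continuous_const.add continuous_snd).tendsto 0
        exact this.eventually_const_lt (by simpa using hl p (List.mem_cons_self ..))
      filter_upwards [h1, h2] with z hz1 hz2
      obtain ⟨l', hl', h⟩ := hz1
      refine ⟨(p.1 + z.2, p.2) :: l', ?_, ?_⟩
      · intro q hq
        rcases List.mem_cons.1 hq with rfl | hq
        exacts [hz2, hl' q hq]
      · rw [propagator_cons, h]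

/-- Here `(1 + H)² = 1`, so `H² = -2H` and `2‖H‖ ≤ ‖H‖²`, which forces `H = 0` when the norm is
below 1. -/
theorem eq_one_of_unitary_of_hermitian {H : Matrix ι ι ℂ} (hH : Hᴴ = H)
    (hU : 1 + H ∈ unitaryGroup ι ℂ) (hn : ‖H‖ < 1) : H = 0 := by
  have h1 : (1 + H) * (1 + H) = 1 := by
    have := mem_unitaryGroup_iff.1 hU
    rwa [star_eq_conjTranspose, conjTranspose_add, hH, conjTranspose_one] at this
  have h2 : H * H = -((2 : ℝ) • H) := by
    have : H * H = (1 + H) * (1 + H) - 1 - (2 : ℝ) • H := by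
      rw [two_smul]; noncomm_ring
    rw [this, h1]; simp
  have h3 : 2 * ‖H‖ ≤ ‖H‖ * ‖H‖ := by
    have := norm_mul_le H H
    rwa [h2, norm_neg, norm_smul, Real.norm_ofNat] at this
  have h4 : ‖H‖ = 0 := by nlinarith [norm_nonneg H]
  exact norm_eq_zero.1 h4

/-- A map into the unitary group whose derivative covers all skew-Hermitian directions is open at
the base point. -/
theorem eventually_mem_image_of_unitary {E : Type*} [NormedAddCommGroup E] [NormedSpace ℝ E]
    [CompleteSpace E] {f : E → Matrix ι ι ℂ} {f' : E →L[ℝ] Matrix ι ι ℂ}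
    (hf : HasStrictFDerivAt f f' 0) (hu : ∀ᶠ x in 𝓝 0, f x ∈ unitaryGroup ι ℂ)
    (hr : ∀ Z : Matrix ι ι ℂ, Zᴴ = -Z → ∃ x, f' x = Z * f 0) {s : Set E} (hs : s ∈ 𝓝 0) :
    ∀ᶠ W in 𝓝 (f 0), W ∈ unitaryGroup ι ℂ → ∃ x ∈ s, f x = W := by
  have hu0 := hu.self_of_nhds
  have hu1 : f 0 * (f 0)ᴴ = 1 := mem_unitaryGroup_iff.1 hu0
  have hu2 : (f 0)ᴴ * f 0 = 1 := mem_unitaryGroup_iff'.1 hu0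
  -- The map `(x, M) ↦ f x * (1 + S M)` supplies the missing Hermitian directions, so it is open
  -- into all matrices. At a unitary value close to `f 0` the Hermitian factor must be 1, and `f x`
  -- alone attains the value.
  let S : Matrix ι ι ℂ →L[ℝ] Matrix ι ι ℂ := LinearMap.toContinuousLinearMap
    { toFun := fun M => M + Mᴴ
      map_add' := fun M M' => by rw [conjTranspose_add]; abel
      map_smul' := fun r M => by simp }
  have hS (M : Matrix ι ι ℂ) : S M = M + Mᴴ := rfl
  have h1 : HasStrictFDerivAt (fun z : E × Matrix ι ι ℂ => f z.1)
      (f'.comp (ContinuousLinearMap.fst ℝ E (Matrix ι ι ℂ))) 0 :=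
    HasStrictFDerivAt.comp (x := (0 : E × Matrix ι ι ℂ)) (g := f) (f := Prod.fst) hf
      hasStrictFDerivAt_fst
  have h2 : HasStrictFDerivAt (fun z : E × Matrix ι ι ℂ => 1 + S z.2)
      (S.comp (ContinuousLinearMap.snd ℝ E (Matrix ι ι ℂ))) 0 :=
    (S.comp (ContinuousLinearMap.snd ℝ E (Matrix ι ι ℂ))).hasStrictFDerivAt.const_add 1
  obtain ⟨h', h3, hv⟩ := HasStrictFDerivAt.exists_mul h1 h2
  have hmap := h3.map_nhds_eq_of_surj (by
    rw [LinearMap.range_eq_top]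
    intro V
    set K := V * (f 0)ᴴ with hK
    obtain ⟨x, hx⟩ := hr ((1 / 2 : ℝ) • (K - Kᴴ)) (by
      rw [conjTranspose_smul, conjTranspose_sub, conjTranspose_conjTranspose, ← smul_neg,
        neg_sub]; simp)
    -- `K` is split into its skew and Hermitian halves. The factor is 1/4 rather than 1/2 because
    -- `S` doubles a Hermitian argument.
    refine ⟨(x, (1 / 4 : ℝ) • ((f 0)ᴴ * (K + Kᴴ) * f 0)), ?_⟩
    have h5 : S ((1 / 4 : ℝ) • ((f 0)ᴴ * (K + Kᴴ) * f 0)) =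
        (1 / 2 : ℝ) • ((f 0)ᴴ * (K + Kᴴ) * f 0) := by
      have : ((f 0)ᴴ * (K + Kᴴ) * f 0)ᴴ = (f 0)ᴴ * (K + Kᴴ) * f 0 := by
        simp only [conjTranspose_mul, conjTranspose_add, conjTranspose_conjTranspose, mul_assoc]
        rw [add_comm]
      rw [hS, conjTranspose_smul, this, star_trivial, ← add_smul]
      norm_num
    have h6 : f 0 * ((1 / 2 : ℝ) • ((f 0)ᴴ * (K + Kᴴ) * f 0)) +
        ((1 / 2 : ℝ) • (K - Kᴴ)) * f 0 = V := by
      have e1 : f 0 * ((f 0)ᴴ * (K + Kᴴ) * f 0) = (K + Kᴴ) * f 0 := by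
        rw [← mul_assoc, ← mul_assoc, hu1, one_mul]
      have e2 : K * f 0 = V := by rw [hK, mul_assoc, hu2, mul_one]
      rw [mul_smul_comm, smul_mul_assoc, ← smul_add, e1, ← add_mul]
      have e3 : K + Kᴴ + (K - Kᴴ) = (2 : ℝ) • K := by rw [two_smul]; abel
      rw [e3, smul_mul_assoc, smul_smul, e2]
      norm_num
    rw [← hx, ← h5] at h6
    refine (hv _).trans ?_
    change f 0 * S _ + f' x * (1 + S 0) = V
    rwa [map_zero, add_zero, mul_one])
  have hΦ0 : (fun z : E × Matrix ι ι ℂ => f z.1 * (1 + S z.2)) 0 = f 0 := by simp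
  have hn : ∀ᶠ z : E × Matrix ι ι ℂ in 𝓝 0,
      z.1 ∈ s ∧ f z.1 ∈ unitaryGroup ι ℂ ∧ ‖S z.2‖ < 1 := by
    have t1 : Tendsto (fun z : E × Matrix ι ι ℂ => z.1) (𝓝 0) (𝓝 0) :=
      continuous_fst.tendsto (0 : E × Matrix ι ι ℂ)
    have t2 : Tendsto (fun z : E × Matrix ι ι ℂ => ‖S z.2‖) (𝓝 0) (𝓝 0) := by
      have : Continuous fun z : E × Matrix ι ι ℂ => ‖S z.2‖ := by fun_prop
      simpa using this.tendsto 0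
    exact (t1.eventually hs).and ((t1.eventually hu).and (t2.eventually_lt_const one_pos))
  have himg : (fun z : E × Matrix ι ι ℂ => f z.1 * (1 + S z.2)) ''
      {z | z.1 ∈ s ∧ f z.1 ∈ unitaryGroup ι ℂ ∧ ‖S z.2‖ < 1} ∈ 𝓝 (f 0) := by
    have := image_mem_map (m := fun z : E × Matrix ι ι ℂ => f z.1 * (1 + S z.2)) hn
    exact (hmap.trans (congrArg 𝓝 hΦ0)).ge this
  filter_upwards [himg] with W hW hWu
  obtain ⟨⟨x, M⟩, ⟨hxs, hxu, hM⟩, rfl⟩ := hW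
  refine ⟨x, hxs, ?_⟩
  have hx2 : (f x)ᴴ * f x = 1 := mem_unitaryGroup_iff'.1 hxu
  have : S M = 0 := by
    refine eq_one_of_unitary_of_hermitian ?_ ?_ hM
    · rw [hS, conjTranspose_add, conjTranspose_conjTranspose, add_comm]
    · have := mul_mem (Unitary.star_mem hxu) hWu
      rwa [star_eq_conjTranspose, ← mul_assoc, hx2, one_mul] at this
  simp [this]

/-- The same with special unitary matrices and traceless directions. -/
theorem eventually_mem_image_of_special_unitary [Nonempty ι] {E : Type*} [NormedAddCommGroup E]
    [NormedSpace ℝ E] [CompleteSpace E] {f : E → Matrix ι ι ℂ} {f' : E →L[ℝ] Matrix ι ι ℂ}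
    (hf : HasStrictFDerivAt f f' 0) (hu : ∀ᶠ x in 𝓝 0, f x ∈ specialUnitaryGroup ι ℂ)
    (hr : ∀ Z ∈ su ι, ∃ x, f' x = Z * f 0) {s : Set E} (hs : s ∈ 𝓝 0) :
    ∀ᶠ W in 𝓝 (f 0), W ∈ specialUnitaryGroup ι ℂ → ∃ x ∈ s, f x = W := by
  -- A scalar phase supplies the missing trace direction, which reduces the claim to the unitary
  -- case.
  set Y : Matrix ι ι ℂ := Complex.I • 1 with hYdef
  have hY : Yᴴ = -Y := by simp [hYdef]
  have h1 : HasStrictFDerivAt (fun z : E × ℝ => f z.1)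
      (f'.comp (ContinuousLinearMap.fst ℝ E ℝ)) 0 :=
    HasStrictFDerivAt.comp (x := (0 : E × ℝ)) (g := f) (f := Prod.fst) hf hasStrictFDerivAt_fst
  have h2 : HasStrictFDerivAt (fun z : E × ℝ => NormedSpace.exp ((0 + z.2) • Y))
      ((ContinuousLinearMap.smulRight (1 : ℝ →L[ℝ] ℝ)
        (Y * NormedSpace.exp ((0 : ℝ) • Y))).comp (ContinuousLinearMap.snd ℝ E ℝ)) 0 :=
    HasStrictFDerivAt.comp (x := (0 : E × ℝ)) (f := Prod.snd)
      (g := fun t : ℝ => NormedSpace.exp ((0 + t) • Y)) (hasStrictFDerivAt_exp_add_smul Y 0)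
      hasStrictFDerivAt_snd
  obtain ⟨h', h3, hv⟩ := HasStrictFDerivAt.exists_mul h1 h2
  have hfst : Tendsto (fun z : E × ℝ => z.1) (𝓝 0) (𝓝 0) := continuous_fst.tendsto (0 : E × ℝ)
  have hsnd : Tendsto (fun z : E × ℝ => z.2) (𝓝 0) (𝓝 0) := continuous_snd.tendsto (0 : E × ℝ)
  have hn : (0 : ℝ) < Fintype.card ι := by exact_mod_cast Fintype.card_pos
  have hpos : 0 < 2 * Real.pi / Fintype.card ι := div_pos Real.two_pi_pos hn
  -- Determinant one leaves only phases that are multiples of 2π divided by the dimension; this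
  -- bound excludes all but zero.
  have hsmall : {z : E × ℝ | (z.1 ∈ s ∧ f z.1 ∈ specialUnitaryGroup ι ℂ) ∧
      |z.2| < 2 * Real.pi / Fintype.card ι} ∈ 𝓝 (0 : E × ℝ) := by
    refine ((hfst.eventually hs).and (hfst.eventually hu)).and ?_
    exact (by simpa using hsnd.abs : Tendsto (fun z : E × ℝ => |z.2|) (𝓝 0) (𝓝 0)).eventually_lt_const
      hpos
  have key := eventually_mem_image_of_unitary h3 ?_ ?_ hsmall
  · have h0 : f (0 : E × ℝ).1 * NormedSpace.exp ((0 + (0 : E × ℝ).2) • Y) = f 0 := by simp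
    rw [h0] at key
    filter_upwards [key] with W hW hWs
    obtain ⟨hWu, hWd⟩ := mem_specialUnitaryGroup_iff.1 hWs
    obtain ⟨⟨x, r⟩, ⟨⟨hxs, hxu⟩, hr'⟩, rfl⟩ := hW hWu
    refine ⟨x, hxs, ?_⟩
    simp only [zero_add] at hWd ⊢
    rw [det_mul, (mem_specialUnitaryGroup_iff.1 hxu).2, one_mul,
      det_exp_skew (conjTranspose_real_smul_skew hY r), Complex.exp_eq_one_iff] at hWd
    obtain ⟨k, hk⟩ := hWd
    have hk' : r * Fintype.card ι = k * (2 * Real.pi) := by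
      have : (r : ℂ) * Fintype.card ι = k * (2 * Real.pi) := by
        apply mul_right_cancel₀ Complex.I_ne_zero
        rw [hYdef, trace_smul, trace_smul, trace_one, Complex.real_smul, smul_eq_mul] at hk
        linear_combination hk
      exact_mod_cast this
    have hk0 : k = 0 := by
      have hr'' : |r| * Fintype.card ι < 2 * Real.pi := (lt_div_iff₀ hn).1 hr'
      rw [← abs_of_pos hn, ← abs_mul, hk', abs_mul, abs_of_pos Real.two_pi_pos] at hr''
      have : |(k : ℝ)| < 1 := by
        by_contra hcon
        have := Real.two_pi_pos
        nlinarith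
      exact Int.abs_lt_one_iff.1 (by exact_mod_cast this)
    have hr0 : r = 0 := by
      rw [hk0, Int.cast_zero, zero_mul] at hk'
      exact (mul_eq_zero.1 hk').resolve_right hn.ne'
    simp [hr0]
  · filter_upwards [hfst.eventually hu] with z hz
    exact mul_mem (mem_specialUnitaryGroup_iff.1 hz).1
      (exp_mem_unitaryGroup (conjTranspose_real_smul_skew hY _))
  · intro Z hZ
    set τ : ℝ := Z.trace.im / Fintype.card ι with hτ
    have hre : Z.trace.re = 0 := by
      have := congrArg (fun M => M.trace.re) hZ
      simp only [trace_conjTranspose, trace_neg, Complex.star_def, Complex.conj_re,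
        Complex.neg_re] at this
      linarith
    have hsu : Z - τ • Y ∈ su ι := by
      refine ⟨?_, ?_⟩
      · rw [conjTranspose_sub, hZ, conjTranspose_real_smul_skew hY]; abel
      · rw [trace_sub, hYdef, trace_smul, trace_smul, trace_one, Complex.real_smul, smul_eq_mul]
        have hn' : (Fintype.card ι : ℂ) ≠ 0 := by exact_mod_cast hn.ne'
        apply Complex.ext
        · simp [hre]
        · simp [hτ, hn.ne']
    obtain ⟨x, hx⟩ := hr _ hsu
    refine ⟨(x, τ), ?_⟩
    rw [hv]
    have : f' x + τ • (f 0 * Y) = Z * f 0 := by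
      rw [hx, sub_mul, smul_mul_assoc, hYdef]; simp
    rw [← add_comm] at this
    simpa using this

end Calculus

/-- Traces of skew-Hermitian matrices are purely imaginary, so `su` has real codimension at most one
among them, and a single element of nonzero trace completes it. -/
theorem su_le_of_trace_ne_zero {𝔩 : Submodule ℝ (Matrix ι ι ℂ)} (hsu : ∀ Z ∈ su ι, Z ∈ 𝔩)
    {Y : Matrix ι ι ℂ} (hY : Yᴴ = -Y) (hY𝔩 : Y ∈ 𝔩) (ht : Y.trace ≠ 0) {Z : Matrix ι ι ℂ}
    (hZ : Zᴴ = -Z) : Z ∈ 𝔩 := by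
  have hre {M : Matrix ι ι ℂ} (hM : Mᴴ = -M) : M.trace.re = 0 := by
    have := congrArg (fun M => M.trace.re) hM
    simp only [trace_conjTranspose, trace_neg, Complex.star_def, Complex.conj_re,
      Complex.neg_re] at this
    linarith
  have him : Y.trace.im ≠ 0 := fun h => ht (Complex.ext (hre hY) h)
  have h : Z - (Z.trace.im / Y.trace.im) • Y ∈ su ι := by
    refine ⟨?_, ?_⟩
    · rw [conjTranspose_sub, hZ, conjTranspose_real_smul_skew hY]; abel
    · rw [trace_sub, trace_smul, Complex.real_smul]
      apply Complex.ext
      · simp [hre hY, hre hZ]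
      · simp [him]
  have := 𝔩.add_mem (hsu _ h) (𝔩.smul_mem (Z.trace.im / Y.trace.im) hY𝔩)
  simpa using this

theorem det_propagator {A B : Matrix ι ι ℂ} (hA : A.IsHermitian) (hB : B.IsHermitian)
    (htA : A.trace = 0) (htB : B.trace = 0) (l : List (ℝ × ℝ)) : (propagator A B l).det = 1 := by
  induction l with
  | nil => exact det_one
  | cons p l ih =>
    rw [propagator_cons, det_mul, ih,
      det_exp_skew (conjTranspose_real_smul_skew (conjTranspose_generator hA hB _) _)]
    simp [generator, htA, htB]

/-- The closed group that contains all propagators: the special unitary group if `A` and `B` are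
traceless, and the unitary group otherwise. -/
def ambientGroup (A B : Matrix ι ι ℂ) : Set (Matrix ι ι ℂ) :=
  {W | W ∈ unitaryGroup ι ℂ ∧ (A.trace = 0 ∧ B.trace = 0 → W.det = 1)}

theorem propagator_mem_ambientGroup {A B : Matrix ι ι ℂ} (hA : A.IsHermitian)
    (hB : B.IsHermitian) (l : List (ℝ × ℝ)) : propagator A B l ∈ ambientGroup A B :=
  ⟨propagator_mem_unitaryGroup hA hB l, fun h => det_propagator hA hB h.1 h.2 l⟩

/-- The velocities at a maximal sequence contain `L₀`. If `A` and `B` are traceless, this covers the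
tangent space of the special unitary group; otherwise `iA` or `iB` has nonzero trace and all
skew-Hermitian directions are covered. -/
theorem exists_propagator_interior [Nonempty ι] {A B : Matrix ι ι ℂ} (hA : A.IsHermitian)
    (hB : B.IsHermitian) (hL : su ι ≤ L₀ A B) :
    ∃ l : List (ℝ × ℝ), (∀ p ∈ l, 0 < p.1) ∧ ∀ᶠ W in 𝓝 (propagator A B l),
      W ∈ ambientGroup A B → ∃ l' : List (ℝ × ℝ), (∀ p ∈ l', 0 < p.1) ∧ propagator A B l' = W := by
  obtain ⟨l, hl, hT⟩ := exists_orbitSpan_le_tangentSpan hA hB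
  refine ⟨l, hl, ?_⟩
  have hLT {Z : Matrix ι ι ℂ} (hZ : Z ∈ L₀ A B) : Z ∈ tangentSpan A B l :=
    hT (L₀_le_orbitSpan hA hB hZ)
  obtain ⟨E, _, _, _, f, f', hf0, hf', hr, hE⟩ := exists_parametrization hA hB l hl
  rw [← hf0] at hr ⊢
  by_cases ht : A.trace = 0 ∧ B.trace = 0
  · have := eventually_mem_image_of_special_unitary hf' (hE.mono ?_)
      (fun Z hZ => hr Z (hLT (hL hZ))) hE
    · filter_upwards [this] with W hW hWG
      obtain ⟨x, ⟨l', hl', h⟩, rfl⟩ := hW (mem_specialUnitaryGroup_iff.2 ⟨hWG.1, hWG.2 ht⟩)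
      exact ⟨l', hl', h⟩
    · rintro x ⟨l', hl', h⟩
      rw [← h]
      exact mem_specialUnitaryGroup_iff.2 ⟨propagator_mem_unitaryGroup hA hB l',
        det_propagator hA hB ht.1 ht.2 l'⟩
  · have hskew : ∀ Z : Matrix ι ι ℂ, Zᴴ = -Z → Z ∈ tangentSpan A B l := by
      intro Z hZ
      rcases not_and_or.1 ht with h | h
      · refine su_le_of_trace_ne_zero (fun Z hZ => hLT (hL hZ)) (Y := Complex.I • A) ?_
          (hLT (LieSubalgebra.subset_lieSpan (by simp))) (by simpa using h) hZ
        simp [hA.eq]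
      · refine su_le_of_trace_ne_zero (fun Z hZ => hLT (hL hZ)) (Y := Complex.I • B) ?_
          (hLT (LieSubalgebra.subset_lieSpan (by simp))) (by simpa using h) hZ
        simp [hB.eq]
    have := eventually_mem_image_of_unitary hf' (hE.mono ?_) (fun Z hZ => hr Z (hskew Z hZ)) hE
    · filter_upwards [this] with W hW hWG
      obtain ⟨x, ⟨l', hl', h⟩, rfl⟩ := hW hWG.1
      exact ⟨l', hl', h⟩
    · rintro x ⟨l', hl', h⟩
      rw [← h]
      exact propagator_mem_unitaryGroup hA hB l'

instance : CompactSpace (unitaryGroup ι ℂ) := by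
  suffices h : IsCompact (unitaryGroup ι ℂ : Set (Matrix ι ι ℂ)) from
    isCompact_iff_compactSpace.1 h
  have hc : IsCompact (Set.univ.pi fun _ : ι => Set.univ.pi fun _ : ι =>
      Metric.closedBall (0 : ℂ) 1) :=
    isCompact_univ_pi fun _ => isCompact_univ_pi fun _ => isCompact_closedBall _ _
  refine hc.of_isClosed_subset (isClosed_unitary (R := Matrix ι ι ℂ)) fun U hU i _ j _ => ?_
  simpa using entry_norm_bound_of_unitary hU i j

/-- Recurrence in a compact group: the nonnegative powers of an element accumulate at its inverse.
This replaces running the drift backwards in time. -/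
theorem conjTranspose_mem_closure_range_pow {V : Matrix ι ι ℂ} (hV : V ∈ unitaryGroup ι ℂ) :
    Vᴴ ∈ closure (Set.range fun n : ℕ => V ^ n) := by
  let v : unitaryGroup ι ℂ := ⟨V, hV⟩
  have h : v⁻¹ ∈ closure (Set.range fun n : ℕ => v ^ n) := by
    refine ((mapClusterPt_atTop_pow_tfae v⁻¹ v).out 0 2).1 ?_
    simpa using mapClusterPt_self_zpow_atTop_pow v (-1)
  have := image_closure_subset_closure_image continuous_subtype_val (Set.mem_image_of_mem _ h)
  rw [← Set.range_comp] at this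
  exact this

theorem propagator_flatten_replicate (A B : Matrix ι ι ℂ) (l : List (ℝ × ℝ)) (n : ℕ) :
    propagator A B (List.replicate n l).flatten = propagator A B l ^ n := by
  induction n with
  | zero => simp [propagator]
  | succ n ih => rw [List.replicate_succ, List.flatten_cons, propagator_append, ih, pow_succ]

/-- Let `P` be an interior propagator and `P ^ n` close to `Pᴴ`. For `W` close to 1, `(P ^ n)ᴴ * W`
is close to `P`, hence reachable; following it by `P ^ n` gives `W`. -/
theorem eventually_nhds_one_exists_propagator [Nonempty ι] {A B : Matrix ι ι ℂ}
    (hA : A.IsHermitian) (hB : B.IsHermitian) (hL : su ι ≤ L₀ A B) :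
    ∀ᶠ W in 𝓝 (1 : Matrix ι ι ℂ), W ∈ ambientGroup A B →
      ∃ l : List (ℝ × ℝ), (∀ p ∈ l, 0 < p.1) ∧ propagator A B l = W := by
  obtain ⟨l, hl, hW⟩ := exists_propagator_interior hA hB hL
  have hcont : Tendsto (fun z : Matrix ι ι ℂ × Matrix ι ι ℂ => z.1ᴴ * z.2)
      (𝓝 ((propagator A B l)ᴴ, 1)) (𝓝 (propagator A B l)) := by
    have : Continuous fun z : Matrix ι ι ℂ × Matrix ι ι ℂ => z.1ᴴ * z.2 := by fun_prop
    simpa using this.tendsto ((propagator A B l)ᴴ, 1)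
  have hev := hcont.eventually hW
  rw [nhds_prod_eq] at hev
  obtain ⟨p, hp, q, hq, hpq⟩ := eventually_prod_iff.1 hev
  have hcl := conjTranspose_mem_closure_range_pow (propagator_mem_unitaryGroup hA hB l)
  obtain ⟨_, hpg, n, rfl⟩ := mem_closure_iff_nhds.1 hcl _ hp
  have hpg' : p (propagator A B l ^ n) := hpg
  rw [← propagator_flatten_replicate] at hpg'
  set l₂ := (List.replicate n l).flatten with hl₂
  have hl₂pos : ∀ p ∈ l₂, 0 < p.1 := by
    intro p hp
    obtain ⟨l', hl', hp'⟩ := List.mem_flatten.1 hp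
    rw [List.eq_of_mem_replicate hl'] at hp'
    exact hl p hp'
  have hG := propagator_mem_ambientGroup hA hB l₂
  have hu : propagator A B l₂ * (propagator A B l₂)ᴴ = 1 := mem_unitaryGroup_iff.1 hG.1
  filter_upwards [hq] with W hqW hWG
  obtain ⟨l', hl', h⟩ := hpq hpg' hqW ⟨mul_mem (Unitary.star_mem hG.1) hWG.1, fun ht => by
    simp [det_mul, det_conjTranspose, hG.2 ht, hWG.2 ht]⟩
  refine ⟨l' ++ l₂, ?_, ?_⟩
  · intro p hp
    rcases List.mem_append.1 hp with h | h
    exacts [hl' p h, hl₂pos p h]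
  · rw [propagator_append, h, ← mul_assoc, hu, one_mul]

/-- A system whose dynamical Lie algebra contains `su` is completely controllable. -/
theorem completelyControllable_of_su_le [Nonempty ι] {A B : Matrix ι ι ℂ}
    (hA : A.IsHermitian) (hB : B.IsHermitian) (hL : su ι ≤ L₀ A B) :
    CompletelyControllable A B := by
  intro W hW
  obtain ⟨Y, ⟨hY, hYt⟩, rfl⟩ := exists_su_exp_eq hW
  have hev := eventually_nhds_one_exists_propagator hA hB hL
  -- A root of `W = exp Y` of high order is close to 1, hence reachable; repeating its control
  -- reaches `W`.
  have ht : Tendsto (fun n : ℕ => NormedSpace.exp ((1 / ((n : ℝ) + 1)) • Y)) atTop (𝓝 1) := by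
    have hc := (hasStrictFDerivAt_exp_add_smul Y 0).hasFDerivAt.continuousAt
    have := hc.tendsto.comp tendsto_one_div_add_atTop_nhds_zero_nat
    simpa [Function.comp_def] using this
  obtain ⟨n, hn⟩ := (ht.eventually hev).exists
  have hYn := conjTranspose_real_smul_skew hY (1 / ((n : ℝ) + 1))
  obtain ⟨l, hl, h⟩ := hn ⟨exp_mem_unitaryGroup hYn, fun _ => by
    rw [det_exp_skew hYn, trace_smul, hYt, smul_zero, Complex.exp_zero]⟩
  refine ⟨(List.replicate (n + 1) l).flatten, ?_, ?_⟩
  · intro p hp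
    obtain ⟨l', hl', hp'⟩ := List.mem_flatten.1 hp
    rw [List.eq_of_mem_replicate hl'] at hp'
    exact (hl p hp').le
  · rw [propagator_flatten_replicate, h, ← exp_nsmul, ← Nat.cast_smul_eq_nsmul ℝ, smul_smul]
    have : ((n + 1 : ℕ) : ℝ) * (1 / ((n : ℝ) + 1)) = 1 := by
      push_cast
      field_simp
    rw [this, one_smul]

end Reachability

/-! ### Reduction to a Lie algebra of real matrices. -/

section RealForm

open Matrix

variable {ι : Type*} [Fintype ι] [DecidableEq ι]

/-- Entrywise complexification of real matrices. -/
noncomputable def complexify : Matrix ι ι ℝ →+* Matrix ι ι ℂ := Complex.ofRealHom.mapMatrix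

theorem complexify_apply (R : Matrix ι ι ℝ) (i j : ι) : complexify R i j = (R i j : ℂ) := rfl

theorem complexify_smul (r : ℝ) (R : Matrix ι ι ℝ) : complexify (r • R) = r • complexify R := by
  ext i j
  simp [complexify_apply]

/-- The real matrices whose antisymmetric part, and `i` times whose symmetric part, belong to
`L`. -/
noncomputable def realForm (L : LieSubalgebra ℝ (Matrix ι ι ℂ)) :
    LieSubalgebra ℝ (Matrix ι ι ℝ) where
  carrier := {R | complexify (R - Rᵀ) ∈ L ∧ Complex.I • complexify (R + Rᵀ) ∈ L}
  zero_mem' := by simp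
  add_mem' := by
    rintro R R' ⟨h1, h2⟩ ⟨h1', h2'⟩
    refine ⟨?_, ?_⟩
    · have := L.add_mem h1 h1'
      rw [← map_add] at this
      convert! this using 2
      rw [transpose_add]; abel
    · have := L.add_mem h2 h2'
      rw [← smul_add, ← map_add] at this
      convert! this using 3
      rw [transpose_add]; abel
  smul_mem' := by
    rintro r R ⟨h1, h2⟩
    refine ⟨?_, ?_⟩
    · have := L.smul_mem r h1
      rwa [← complexify_smul, smul_sub, ← transpose_smul] at this
    · have := L.smul_mem r h2
      rwa [smul_comm, ← complexify_smul, smul_add, ← transpose_smul] at this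
  lie_mem' := by
    rintro R R' ⟨h1, h2⟩ ⟨h1', h2'⟩
    refine ⟨?_, ?_⟩
    · have h := L.smul_mem (1 / 2 : ℝ) (L.sub_mem (L.lie_mem h1 h1') (L.lie_mem h2 h2'))
      convert! h using 1
      have e : ⁅Complex.I • complexify (R + Rᵀ), Complex.I • complexify (R' + R'ᵀ)⁆ =
          -⁅complexify (R + Rᵀ), complexify (R' + R'ᵀ)⁆ := by
        simp only [Ring.lie_def, smul_mul_smul, Complex.I_mul_I, neg_smul, one_smul]
        abel
      rw [e, one_div, eq_inv_smul_iff₀ (by norm_num : (2 : ℝ) ≠ 0), two_smul]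
      simp only [Ring.lie_def, transpose_sub, transpose_mul, map_sub, map_add, map_mul]
      noncomm_ring
    · have h := L.smul_mem (1 / 2 : ℝ) (L.add_mem (L.lie_mem h1 h2') (L.lie_mem h2 h1'))
      convert! h using 1
      have e : ⁅complexify (R - Rᵀ), Complex.I • complexify (R' + R'ᵀ)⁆ +
          ⁅Complex.I • complexify (R + Rᵀ), complexify (R' - R'ᵀ)⁆ =
          Complex.I • (⁅complexify (R - Rᵀ), complexify (R' + R'ᵀ)⁆ +
          ⁅complexify (R + Rᵀ), complexify (R' - R'ᵀ)⁆) := by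
        simp only [Ring.lie_def, smul_mul_assoc, mul_smul_comm, smul_sub, smul_add]
      rw [e, one_div, eq_inv_smul_iff₀ (by norm_num : (2 : ℝ) ≠ 0), smul_comm, two_smul]
      congr 1
      simp only [Ring.lie_def, transpose_sub, transpose_mul, map_sub, map_add, map_mul]
      noncomm_ring

theorem mem_realForm {L : LieSubalgebra ℝ (Matrix ι ι ℂ)} {R : Matrix ι ι ℝ} :
    R ∈ realForm L ↔ complexify (R - Rᵀ) ∈ L ∧ Complex.I • complexify (R + Rᵀ) ∈ L := Iff.rfl

theorem transpose_mem_realForm {L : LieSubalgebra ℝ (Matrix ι ι ℂ)} {R : Matrix ι ι ℝ}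
    (h : R ∈ realForm L) : Rᵀ ∈ realForm L := by
  rw [mem_realForm] at h ⊢
  rw [transpose_transpose, add_comm, ← neg_sub, map_neg]
  exact ⟨neg_mem h.1, h.2⟩

theorem symm_mem_realForm {L : LieSubalgebra ℝ (Matrix ι ι ℂ)} {R : Matrix ι ι ℝ}
    (hR : Rᵀ = R) (h : Complex.I • complexify R ∈ L) : R ∈ realForm L := by
  rw [mem_realForm, hR, sub_self, map_zero, map_add, smul_add]
  exact ⟨zero_mem _, add_mem h h⟩

/-- The real part of a skew-Hermitian matrix is antisymmetric and the imaginary part symmetric, so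
each is half of the combination that `realForm` places in `L`. -/
theorem su_le_of_realForm {L : LieSubalgebra ℝ (Matrix ι ι ℂ)}
    (h : ∀ R : Matrix ι ι ℝ, R.trace = 0 → R ∈ realForm L) : su ι ≤ L := by
  rintro A ⟨hA, hAt⟩
  have hij (i j : ι) : star (A j i) = -A i j := by
    have := congrFun (congrFun hA i) j
    simpa using this
  have hre (i j : ι) : (A j i).re = -(A i j).re := by simpa using congrArg Complex.re (hij i j)
  have him (i j : ι) : (A j i).im = (A i j).im := by simpa using congrArg Complex.im (hij i j)
  have h1 := (h (A.map Complex.re) (by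
    have := congrArg Complex.re hAt
    simpa [trace] using this)).1
  have h2 := (h (A.map Complex.im) (by
    have := congrArg Complex.im hAt
    simpa [trace] using this)).2
  have := L.smul_mem (1 / 2 : ℝ) (L.add_mem h1 h2)
  have e : A = (1 / 2 : ℝ) • (complexify (A.map Complex.re - (A.map Complex.re)ᵀ) +
      Complex.I • complexify (A.map Complex.im + (A.map Complex.im)ᵀ)) := by
    refine Matrix.ext fun i j => Complex.ext ?_ ?_
    · simp [complexify_apply, hre i j]
      ring
    · simp [complexify_apply, him i j]
      ring
  rwa [← e] at this

/-- Brackets of opposite units give the differences of diagonal units. With one diagonal unit fixed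
as reference, its total coefficient in `R` is the trace and drops out. -/
theorem mem_of_single_mem {M : LieSubalgebra ℝ (Matrix ι ι ℝ)}
    (h : ∀ i j : ι, i ≠ j → single i j (1 : ℝ) ∈ M) {R : Matrix ι ι ℝ} (hR : R.trace = 0) :
    R ∈ M := by
  rcases isEmpty_or_nonempty ι with hι | hι
  · rw [Subsingleton.elim R 0]
    exact zero_mem _
  have hs (i j : ι) (hij : i ≠ j) (r : ℝ) : single i j r ∈ M := by
    have := M.smul_mem r (h i j hij)
    simpa using this
  let k : ι := Classical.arbitrary ι
  have hd (i : ι) : single i i (1 : ℝ) - single k k 1 ∈ M := by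
    by_cases hik : i = k
    · rw [hik, sub_self]; exact zero_mem _
    · have := M.lie_mem (h i k hik) (h k i (Ne.symm hik))
      simpa [Ring.lie_def] using this
  have hsum : R = ∑ i, ∑ j, (if i = j then R i i • (single i i (1 : ℝ) - single k k 1)
      else single i j (R i j)) := by
    have hdiag : ∑ i, R i i • single k k (1 : ℝ) = 0 := by
      rw [← Finset.sum_smul]
      rw [show ∑ i, R i i = 0 from hR, zero_smul]
    have : ∀ i, (∑ j, if i = j then R i i • (single i i (1 : ℝ) - single k k 1)
      else single i j (R i j)) = ∑ j, single i j (R i j) - R i i • single k k (1 : ℝ) := by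
      intro i
      rw [eq_sub_iff_add_eq, ← Finset.sum_add_sum_compl {i}, ← Finset.sum_add_sum_compl {i}]
      rw [Finset.sum_singleton, Finset.sum_singleton, if_pos rfl, smul_sub, smul_single]
      rw [Finset.sum_congr rfl (g := fun j => single i j (R i j))]
      · simp
        abel
      · intro j hj
        rw [if_neg]
        rintro rfl
        simp at hj
    simp only [this]
    rw [Finset.sum_sub_distrib, hdiag, sub_zero]
    exact matrix_eq_sum_single R
  rw [hsum]
  refine sum_mem fun i _ => sum_mem fun j _ => ?_
  split_ifs with hij
  · exact M.smul_mem _ (hd i)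
  · exact hs i j hij _

end RealForm

/-! ### Raising operators and the recursion matrices. -/

section Levels

open Matrix

variable {N : ℕ}

theorem mem_states {n k : ℕ} :
    (n, k) ∈ states N ↔ (1 ≤ n ∧ n ≤ N) ∧ (1 ≤ k ∧ k ≤ 2) ∧ k ≤ β n := by
  simp [states, and_assoc]

theorem β_one : β 1 = 1 := rfl

theorem β_of_two_le {n : ℕ} (hn : 2 ≤ n) : β n = 2 := if_neg (by omega)

theorem β_le_two (n : ℕ) : β n ≤ 2 := by
  rw [β]; split_ifs <;> norm_num

theorem State.bounds (s : State N) :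
    1 ≤ s.1.1 ∧ s.1.1 ≤ N ∧ 1 ≤ s.1.2 ∧ s.1.2 ≤ β s.1.1 := by
  obtain ⟨⟨n, k⟩, h⟩ := s
  have := mem_states.1 h
  exact ⟨this.1.1, this.1.2, this.2.1.1, this.2.2⟩

/-- The state `|n,k⟩`. -/
def mkState (n k : ℕ) (h1 : 1 ≤ n) (h2 : n ≤ N) (h3 : 1 ≤ k) (h4 : k ≤ β n) : State N :=
  ⟨(n, k), mem_states.2 ⟨⟨h1, h2⟩, ⟨h3, h4.trans (β_le_two n)⟩, h4⟩⟩

theorem State.ext_iff' {s t : State N} : s = t ↔ s.1.1 = t.1.1 ∧ s.1.2 = t.1.2 := by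
  rw [Subtype.ext_iff, Prod.ext_iff]

theorem State.label_eq_one {s : State N} (h : s.1.1 = 1) : s.1.2 = 1 := by
  have := s.bounds
  rw [h, β_one] at this
  omega

theorem State.label_eq {s : State N} : s.1.2 = 1 ∨ s.1.2 = 2 := by
  have := s.bounds
  have := β_le_two s.1.1
  omega

theorem sum_level {n : ℕ} (h1 : 1 ≤ n) (h2 : n ≤ N) (g : ℕ → ℝ) :
    ∑ u : State N, (if u.1.1 = n then g u.1.2 else 0) = ∑ k ∈ Finset.Icc 1 (β n), g k := by
  rw [Finset.sum_coe_sort (states N) fun u => if u.1 = n then g u.2 else 0, states,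
    Finset.sum_filter, Finset.sum_product]
  have : ∀ m ∈ Finset.Icc 1 N, (∑ k ∈ Finset.Icc 1 2,
      if k ≤ β m then (if m = n then g k else 0) else 0) =
      if m = n then ∑ k ∈ Finset.Icc 1 (β n), g k else 0 := by
    intro m _
    split_ifs with h
    · rw [h, ← Finset.sum_filter]
      refine Finset.sum_congr ?_ fun _ _ => rfl
      ext k
      have := β_le_two n
      simp only [Finset.mem_filter, Finset.mem_Icc]
      omega
    · simp
  rw [Finset.sum_congr rfl this, Finset.sum_ite_eq' (Finset.Icc 1 N) n, if_pos (by simp [h1, h2])]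

theorem sum_Icc_one_two (g : ℕ → ℝ) : ∑ k ∈ Finset.Icc 1 2, g k = g 1 + g 2 := by
  rw [show Finset.Icc 1 2 = {1, 2} from rfl, Finset.sum_pair (by norm_num)]

/-- The operator `∑ W_{nj,n+1 p} |n,j⟩⟨n+1,p|`, as a linear function of its coefficients. -/
def raise (N : ℕ) : (ℕ → ℕ → ℕ → ℝ) →ₗ[ℝ] Matrix (State N) (State N) ℝ where
  toFun W := Matrix.of fun s t => if t.1.1 = s.1.1 + 1 then W s.1.1 s.1.2 t.1.2 else 0
  map_add' W W' := by
    ext s t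
    simp only [of_apply, Matrix.add_apply, Pi.add_apply]
    split_ifs <;> simp
  map_smul' r W := by
    ext s t
    simp only [of_apply, Matrix.smul_apply, Pi.smul_apply, RingHom.id_apply]
    split_ifs <;> simp

theorem raise_apply (W : ℕ → ℕ → ℕ → ℝ) (s t : State N) :
    raise N W s t = if t.1.1 = s.1.1 + 1 then W s.1.1 s.1.2 t.1.2 else 0 := rfl

theorem raise_congr {W W' : ℕ → ℕ → ℕ → ℝ}
    (h : ∀ n j p, 1 ≤ n → n ≤ N - 1 → 1 ≤ j → j ≤ β n → 1 ≤ p → p ≤ 2 → W n j p = W' n j p) :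
    raise N W = raise N W' := by
  ext s t
  rw [raise_apply, raise_apply]
  split_ifs with hst
  · have hs := s.bounds
    have ht := t.bounds
    have := β_le_two t.1.1
    exact h _ _ _ hs.1 (by omega) hs.2.2.1 hs.2.2.2 ht.2.2.1 (by omega)
  · rfl

/-- The matrix elements of `[X, Xᵀ]` within the `n`-th level, where `X = raise N d`. -/
noncomputable def levelEntry (N : ℕ) (d : ℕ → ℕ → ℕ → ℝ) (n j k : ℕ) : ℝ :=
  if j = k then Ksq N d n j else -b N d (n - 1)

/-- The block diagonal operator with the blocks `levelEntry`. -/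
noncomputable def levelOp (N : ℕ) (d : ℕ → ℕ → ℕ → ℝ) : Matrix (State N) (State N) ℝ :=
  Matrix.of fun s t => if s.1.1 = t.1.1 then levelEntry N d s.1.1 s.1.2 t.1.2 else 0

/-- Gathers the boundary conventions for `Ksq` and `b` into one formula: couplings upward minus
couplings downward, a missing neighbour contributing nothing. Level 1 has a single state, so the
meaningless value of `b` at index 0 never enters. -/
theorem levelEntry_eq (hN : 3 ≤ N) (d : ℕ → ℕ → ℕ → ℝ) {n j k : ℕ} (h1 : 1 ≤ n) (h2 : n ≤ N)
    (hj : 1 ≤ j) (hj' : j ≤ β n) (hk : 1 ≤ k) (hk' : k ≤ β n) :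
    levelEntry N d n j k =
      (if n < N then ∑ p ∈ Finset.Icc 1 (β (n + 1)), d n j p * d n k p else 0) -
      (if 1 < n then ∑ c ∈ Finset.Icc 1 (β (n - 1)), d (n - 1) c j * d (n - 1) c k else 0) := by
  have hβ : β (n + 1) = 2 := β_of_two_le (by omega)
  rw [hβ, sum_Icc_one_two]
  rcases Nat.lt_or_ge 1 n with hn | hn
  swap
  · obtain rfl : n = 1 := by omega
    rw [β_one] at hj' hk'
    obtain rfl : j = 1 := by omega
    obtain rfl : k = 1 := by omega
    rw [levelEntry, if_pos rfl, Ksq, if_pos rfl, if_pos (by omega), if_neg (by omega)]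
    ring
  rw [if_pos hn]
  rw [β_of_two_le (by omega : 2 ≤ n)] at hj' hk'
  have hoff : -b N d (n - 1) =
      (if n < N then d n 1 1 * d n 2 1 + d n 1 2 * d n 2 2 else 0) -
        ∑ c ∈ Finset.Icc 1 (β (n - 1)), d (n - 1) c 1 * d (n - 1) c 2 := by
    rcases Nat.lt_or_ge 2 n with hn2 | hn2
    · rw [β_of_two_le (by omega : 2 ≤ n - 1), sum_Icc_one_two, b, if_neg (by omega)]
      split_ifs with h3 h4 h4
      · omega
      · ring
      · rw [show n - 1 + 1 = n by omega]; ring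
      · omega
    · obtain rfl : n = 2 := by omega
      rw [b, if_pos rfl, if_pos (by omega)]
      simp [β]
      ring
  have hdiag : ∀ j, Ksq N d n j = (if n < N then d n j 1 * d n j 1 + d n j 2 * d n j 2 else 0) -
        ∑ c ∈ Finset.Icc 1 (β (n - 1)), d (n - 1) c j * d (n - 1) c j := by
    intro j
    rw [Ksq, if_neg (by omega)]
    split_ifs with h3 h4 h4
    · omega
    · rw [β_of_two_le (by omega : 2 ≤ n - 1), sum_Icc_one_two, h3]
      ring
    · rw [hβ, sum_Icc_one_two]
      simp only [sq]
    · omega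
  rw [levelEntry]
  have hj2 : j = 1 ∨ j = 2 := by omega
  have hk2 : k = 1 ∨ k = 2 := by omega
  rcases hj2 with rfl | rfl <;> rcases hk2 with rfl | rfl
  · rw [if_pos rfl, hdiag]
  · rw [if_neg (by norm_num), hoff]
  · rw [if_neg (by norm_num), hoff]
    simp only [mul_comm]
  · rw [if_pos rfl, hdiag]

theorem lie_raise_transpose (hN : 3 ≤ N) (d : ℕ → ℕ → ℕ → ℝ) :
    ⁅raise N d, (raise N d)ᵀ⁆ = levelOp N d := by
  ext s t
  have hs := s.bounds
  have ht := t.bounds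
  rw [Ring.lie_def, Matrix.sub_apply, Matrix.mul_apply, Matrix.mul_apply, levelOp, of_apply]
  simp only [transpose_apply, raise_apply]
  by_cases hst : s.1.1 = t.1.1
  · rw [if_pos hst, levelEntry_eq hN d hs.1 hs.2.1 hs.2.2.1 hs.2.2.2 ht.2.2.1 (hst ▸ ht.2.2.2)]
    congr 1
    · by_cases h : s.1.1 < N
      · rw [if_pos h, ← sum_level (N := N) (by omega) (by omega)
          (fun p => d s.1.1 s.1.2 p * d s.1.1 t.1.2 p)]
        refine Finset.sum_congr rfl fun u _ => ?_
        rw [← hst]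
        split_ifs <;> simp
      · rw [if_neg h]
        refine Finset.sum_eq_zero fun u _ => ?_
        have := u.bounds
        rw [if_neg (by omega), zero_mul]
    · by_cases h : 1 < s.1.1
      · rw [if_pos h, ← sum_level (N := N) (by omega) (by omega)
          (fun c => d (s.1.1 - 1) c s.1.2 * d (s.1.1 - 1) c t.1.2)]
        refine Finset.sum_congr rfl fun u _ => ?_
        rw [← hst]
        have : s.1.1 = u.1.1 + 1 ↔ u.1.1 = s.1.1 - 1 := by omega
        simp only [this]
        split_ifs with h
        · rw [h]
        · simp
      · rw [if_neg h]
        refine Finset.sum_eq_zero fun u _ => ?_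
        have := u.bounds
        rw [if_neg (by omega), zero_mul]
  · rw [if_neg hst, Finset.sum_eq_zero, Finset.sum_eq_zero, sub_zero]
    · intro u _
      by_cases h : s.1.1 = u.1.1 + 1
      · rw [if_neg (by omega : ¬ t.1.1 = u.1.1 + 1), mul_zero]
      · rw [if_neg h, zero_mul]
    · intro u _
      by_cases h : u.1.1 = s.1.1 + 1
      · rw [if_neg (by omega : ¬ u.1.1 = t.1.1 + 1), mul_zero]
      · rw [if_neg h, zero_mul]

/-- The action of `-ad [X, Xᵀ]` on the coefficients of raising operators. -/
noncomputable def recursion (N : ℕ) (d : ℕ → ℕ → ℕ → ℝ) :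
    (ℕ → ℕ → ℕ → ℝ) →ₗ[ℝ] (ℕ → ℕ → ℕ → ℝ) where
  toFun W := fun n j p => ∑ q ∈ Finset.Icc 1 (β (n + 1)), W n j q * levelEntry N d (n + 1) q p -
    ∑ q ∈ Finset.Icc 1 (β n), levelEntry N d n j q * W n q p
  map_add' W W' := by
    funext n j p
    simp only [Pi.add_apply, add_mul, mul_add, Finset.sum_add_distrib]
    ring
  map_smul' r W := by
    funext n j p
    simp only [Pi.smul_apply, smul_eq_mul, RingHom.id_apply, mul_sub, Finset.mul_sum]
    congr 1 <;> refine Finset.sum_congr rfl fun _ _ => ?_ <;> ring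

theorem recursion_apply (d W : ℕ → ℕ → ℕ → ℝ) (n j p : ℕ) :
    recursion N d W n j p =
      ∑ q ∈ Finset.Icc 1 (β (n + 1)), W n j q * levelEntry N d (n + 1) q p -
      ∑ q ∈ Finset.Icc 1 (β n), levelEntry N d n j q * W n q p := rfl

theorem lie_raise_levelOp (d W : ℕ → ℕ → ℕ → ℝ) :
    ⁅raise N W, levelOp N d⁆ = raise N (recursion N d W) := by
  ext s t
  have hs := s.bounds
  have ht := t.bounds
  rw [Ring.lie_def, Matrix.sub_apply, Matrix.mul_apply, Matrix.mul_apply]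
  simp only [levelOp, of_apply, raise_apply]
  split_ifs with hst
  · rw [recursion_apply, ← hst]
    congr 1
    · rw [← sum_level (N := N) ht.1 ht.2.1
        (fun q => W s.1.1 s.1.2 q * levelEntry N d t.1.1 q t.1.2)]
      refine Finset.sum_congr rfl fun u _ => ?_
      split_ifs with h
      · rw [h]
      · simp
    · rw [← sum_level (N := N) hs.1 hs.2.1
        (fun q => levelEntry N d s.1.1 s.1.2 q * W s.1.1 q t.1.2)]
      refine Finset.sum_congr rfl fun u _ => ?_
      by_cases h : u.1.1 = s.1.1
      · rw [if_pos h.symm, if_pos h, if_pos (by omega), h]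
      · rw [if_neg (Ne.symm h), if_neg h, zero_mul]
  · rw [Finset.sum_eq_zero, Finset.sum_eq_zero, sub_zero]
    · intro u _
      by_cases h : s.1.1 = u.1.1
      · rw [if_neg (by omega : ¬ t.1.1 = u.1.1 + 1), mul_zero]
      · rw [if_neg h, zero_mul]
    · intro u _
      by_cases h : u.1.1 = s.1.1 + 1
      · rw [if_neg (by omega : ¬ u.1.1 = t.1.1), mul_zero]
      · rw [if_neg h, zero_mul]

/-- The coefficients of a raising operator between the levels `1` and `2`. -/
def firstBlock : (ℕ → ℕ → ℕ → ℝ) →ₗ[ℝ] (Fin 2 → ℝ) where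
  toFun W := ![W 1 1 1, W 1 1 2]
  map_add' W W' := by simp
  map_smul' r W := by simp

/-- The coefficients of a raising operator between the levels `i` and `i + 1`. -/
def block (i : ℕ) : (ℕ → ℕ → ℕ → ℝ) →ₗ[ℝ] (Fin 4 → ℝ) where
  toFun W := ![W i 1 1, W i 1 2, W i 2 1, W i 2 2]
  map_add' W W' := by simp
  map_smul' r W := by simp

theorem firstBlock_apply (W : ℕ → ℕ → ℕ → ℝ) : firstBlock W = ![W 1 1 1, W 1 1 2] := rfl

theorem block_apply (i : ℕ) (W : ℕ → ℕ → ℕ → ℝ) :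
    block i W = ![W i 1 1, W i 1 2, W i 2 1, W i 2 2] := rfl

/-- If `K_n` is the block of `[X, Xᵀ]` at level `n`, the recursion sends a coupling block `W` to `W
K₂ - K₁ W`, and in general to `W K_{i+1} - K_i W`. Hence the differences `ν` on the diagonal and the
signs of the entries `b`. -/
theorem firstBlock_recursion (d W : ℕ → ℕ → ℕ → ℝ) :
    firstBlock (recursion N d W) = G₁ N d *ᵥ firstBlock W := by
  funext k
  fin_cases k <;>
  simp [firstBlock_apply, recursion_apply, β, G₁, ν, Matrix.mulVec, dotProduct, Fin.sum_univ_two,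
    sum_Icc_one_two, levelEntry] <;> ring

theorem block_recursion (d W : ℕ → ℕ → ℕ → ℝ) {i : ℕ} (hi : 2 ≤ i) :
    block i (recursion N d W) = G N d i *ᵥ block i W := by
  funext k
  have h1 := β_of_two_le hi
  have h2 := β_of_two_le (by omega : 2 ≤ i + 1)
  fin_cases k <;>
  simp [block_apply, recursion_apply, h1, h2, G, ν, Matrix.mulVec, dotProduct, Fin.sum_univ_four,
    sum_Icc_one_two, levelEntry] <;> ring

/-- The space of coefficient functions is infinite-dimensional; this transfers polynomials in the
recursion to the finite blocks, where Cayley–Hamilton is available. -/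
theorem aeval_semiconj {V : Type*} [AddCommGroup V] [Module ℝ V] {m : ℕ} (τ : Module.End ℝ V)
    (π : V →ₗ[ℝ] (Fin m → ℝ)) (A : Matrix (Fin m) (Fin m) ℝ) (h : ∀ v, π (τ v) = A *ᵥ π v)
    (Q : Polynomial ℝ) (v : V) :
    π (Polynomial.aeval τ Q v) = Polynomial.aeval A Q *ᵥ π v := by
  induction Q using Polynomial.induction_on' generalizing v with
  | add p q hp hq => simp [hp, hq, Matrix.add_mulVec]
  | monomial n a =>
    have hn : ∀ v, π ((τ ^ n) v) = A ^ n *ᵥ π v := by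
      induction n with
      | zero => simp
      | succ n ih => intro v; rw [pow_succ, pow_succ, Module.End.mul_apply, ih, h, mulVec_mulVec]
    simp [Polynomial.aeval_monomial, hn, Algebra.algebraMap_eq_smul_one, Matrix.smul_mulVec]

theorem aeval_mem_of_invariant {V : Type*} [AddCommGroup V] [Module ℝ V] (τ : Module.End ℝ V)
    (S : Submodule ℝ V) (h : ∀ v ∈ S, τ v ∈ S) (Q : Polynomial ℝ) {v : V} (hv : v ∈ S) :
    Polynomial.aeval τ Q v ∈ S := by
  induction Q using Polynomial.induction_on' with
  | add p q hp hq => simpa using add_mem hp hq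
  | monomial n a =>
    have hn : (τ ^ n) v ∈ S := by
      induction n with
      | zero => simpa
      | succ n ih => rw [pow_succ']; exact h _ ih
    simpa [Polynomial.aeval_monomial, Algebra.algebraMap_eq_smul_one] using S.smul_mem a hn

end Levels

/-! ### Generating all matrix units from the raising operator. -/

section Generation

open Matrix

variable {N : ℕ} {M : LieSubalgebra ℝ (Matrix (State N) (State N) ℝ)}

theorem single_mem_trans {i j k : State N} (h1 : single i j (1 : ℝ) ∈ M)
    (h2 : single j k (1 : ℝ) ∈ M) (hik : i ≠ k) : single i k (1 : ℝ) ∈ M := by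
  have := M.lie_mem h1 h2
  rwa [Ring.lie_def, single_mul_single_same, single_mul_single_of_ne _ _ _ _ hik.symm, one_mul,
    sub_zero] at this

/-- `M` contains all matrix units between different states of the levels up to `n`. -/
def ContainsUnits (M : LieSubalgebra ℝ (Matrix (State N) (State N) ℝ)) (n : ℕ) : Prop :=
  ∀ s t : State N, s ≠ t → s.1.1 ≤ n → t.1.1 ≤ n → single s t (1 : ℝ) ∈ M

/-- Every remaining unit is a bracket of two known ones through a state of level `n`; transposition
reverses the direction. -/
theorem ContainsUnits.succ (hT : ∀ A ∈ M, Aᵀ ∈ M) {n : ℕ} (h1 : 1 ≤ n) (h2 : n ≤ N)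
    (hn : ContainsUnits M n)
    (h : ∀ a t : State N, a.1.1 = n → t.1.1 = n + 1 → single a t (1 : ℝ) ∈ M) :
    ContainsUnits M (n + 1) := by
  have hup : ∀ s t : State N, s.1.1 ≤ n → t.1.1 = n + 1 → single s t (1 : ℝ) ∈ M := by
    intro s t hs ht
    let a : State N := mkState n 1 h1 h2 le_rfl (by rw [β]; split_ifs <;> norm_num)
    by_cases hsa : s = a
    · exact h s t (by rw [hsa]; rfl) ht
    · refine single_mem_trans (hn s a hsa hs le_rfl) (h a t rfl ht) ?_
      rintro rfl
      omega
  have hdown : ∀ s t : State N, s.1.1 = n + 1 → t.1.1 ≤ n → single s t (1 : ℝ) ∈ M := by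
    intro s t hs ht
    have := hT _ (hup t s ht hs)
    rwa [transpose_single] at this
  intro s t hst hs ht
  rcases Nat.lt_or_ge n s.1.1 with hs' | hs' <;> rcases Nat.lt_or_ge n t.1.1 with ht' | ht'
  · let a : State N := mkState n 1 h1 h2 le_rfl (by rw [β]; split_ifs <;> norm_num)
    exact single_mem_trans (hdown s a (by omega) le_rfl) (hup a t le_rfl (by omega)) hst
  · exact hdown s t (by omega) ht'
  · exact hup s t hs' (by omega)
  · exact hn s t hst hs' ht'

theorem containsUnits_one (M : LieSubalgebra ℝ (Matrix (State N) (State N) ℝ)) :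
    ContainsUnits M 1 := by
  intro s t hst hs ht
  have hs1 : s.1.1 = 1 := le_antisymm hs s.bounds.1
  have ht1 : t.1.1 = 1 := le_antisymm ht t.bounds.1
  exact (hst (State.ext_iff'.2 ⟨hs1.trans ht1.symm,
    (State.label_eq_one hs1).trans (State.label_eq_one ht1).symm⟩)).elim

theorem ContainsUnits.mem_of_support {n : ℕ} (hn : ContainsUnits M n)
    {R : Matrix (State N) (State N) ℝ}
    (hR : ∀ s t, R s t ≠ 0 → s ≠ t ∧ s.1.1 ≤ n ∧ t.1.1 ≤ n) : R ∈ M := by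
  rw [matrix_eq_sum_single R]
  refine sum_mem fun s _ => sum_mem fun t _ => ?_
  by_cases h : R s t = 0
  · rw [h, single_zero]
    exact zero_mem _
  · obtain ⟨h1, h2, h3⟩ := hR s t h
    simpa using M.smul_mem (R s t) (hn s t h1 h2 h3)

/-- The couplings between the levels from `n` on. -/
def tailCoupling (n : ℕ) (d : ℕ → ℕ → ℕ → ℝ) : ℕ → ℕ → ℕ → ℝ :=
  fun m j p => if n ≤ m then d m j p else 0

/-- The couplings below level `n` are combinations of units already in `M` and can be subtracted
from `X`. -/
theorem raise_tailCoupling_mem {d : ℕ → ℕ → ℕ → ℝ} (hX : raise N d ∈ M) {n : ℕ}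
    (hn : ContainsUnits M n) : raise N (tailCoupling n d) ∈ M := by
  have h : raise N d - raise N (tailCoupling n d) ∈ M := by
    refine hn.mem_of_support fun s t hst => ?_
    rw [Matrix.sub_apply, raise_apply, raise_apply, tailCoupling] at hst
    split_ifs at hst with h1 h2
    · simp at hst
    · refine ⟨?_, by omega, by omega⟩
      rintro rfl
      omega
    · simp at hst
  have := sub_mem hX h
  rwa [sub_sub_cancel] at this

theorem raise_tailCoupling_mul_single (d : ℕ → ℕ → ℕ → ℝ) {n : ℕ} {a b : State N}
    (ha : a.1.1 ≤ n) : raise N (tailCoupling n d) * single a b (1 : ℝ) = 0 := by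
  ext s t
  rw [Matrix.mul_apply, Matrix.zero_apply]
  refine Finset.sum_eq_zero fun u _ => ?_
  rw [raise_apply, tailCoupling, single_apply]
  split_ifs with h1 h2 h3
  · rw [← h3.1] at h1
    omega
  all_goals simp

theorem single_mul_raise_tailCoupling (d : ℕ → ℕ → ℕ → ℝ) {n : ℕ} (h1 : 1 ≤ n) (h2 : n + 1 ≤ N)
    {a b : State N} (hb : b.1.1 = n) :
    single a b (1 : ℝ) * raise N (tailCoupling n d) =
      d n b.1.2 1 • single a (mkState (n + 1) 1 (Nat.le_add_left 1 n) h2 le_rfl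
        (one_le_two.trans (β_of_two_le (Nat.succ_le_succ h1)).ge)) (1 : ℝ) +
      d n b.1.2 2 • single a (mkState (n + 1) 2 (Nat.le_add_left 1 n) h2 one_le_two
        (β_of_two_le (Nat.succ_le_succ h1)).ge) (1 : ℝ) := by
  ext s t
  rw [Matrix.add_apply, Matrix.smul_apply, Matrix.smul_apply]
  by_cases hs : s = a
  · subst hs
    rw [single_mul_apply_same, one_mul, raise_apply, tailCoupling, hb, if_pos le_rfl]
    simp only [single_apply, State.ext_iff', mkState, true_and]
    rcases t.label_eq with h | h <;> by_cases ht : t.1.1 = n + 1 <;> simp [h, ht, eq_comm]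
  · rw [single_mul_apply_of_ne _ _ _ _ _ hs]
    simp [Ne.symm hs]

/-- Multiplying the tail of `X` by the unit from `a` to `b` moves row `b` of the coupling block to
row `a`. Thus `M` contains both rows of the block placed in row `a`, and Cramer's rule isolates the
individual units. -/
theorem ContainsUnits.succ_of_det_ne_zero (hT : ∀ A ∈ M, Aᵀ ∈ M) {d : ℕ → ℕ → ℕ → ℝ}
    (hX : raise N d ∈ M) {n : ℕ} (h1 : 2 ≤ n) (h2 : n ≤ N - 1)
    (hdet : d n 1 1 * d n 2 2 ≠ d n 1 2 * d n 2 1) (hn : ContainsUnits M n) :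
    ContainsUnits M (n + 1) := by
  refine hn.succ hT (by omega) (by omega) ?_
  have htail := raise_tailCoupling_mem hX hn
  have hne : ∀ a b : State N, a.1.1 = n → b.1.1 = n → a ≠ b →
      single a b (1 : ℝ) * raise N (tailCoupling n d) ∈ M := by
    intro a b ha hb hab
    have := M.lie_mem (hn a b hab ha.le hb.le) htail
    rwa [Ring.lie_def, raise_tailCoupling_mul_single d ha.le, sub_zero] at this
  have hβ := β_of_two_le h1
  have hβ' : 2 ≤ β (n + 1) := (β_of_two_le (by omega)).ge
  have h1β : 1 ≤ β n := by omega
  have hn1 : 1 ≤ n := by omega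
  have hnN' : n ≤ N := by omega
  have hnN : n + 1 ≤ N := by omega
  let e₁ : State N := mkState n 1 hn1 hnN' le_rfl h1β
  let e₂ : State N := mkState n 2 hn1 hnN' one_le_two hβ.ge
  have he : e₁ ≠ e₂ := fun h => by simpa [e₁, e₂, mkState] using (State.ext_iff'.1 h).2
  have hcases : ∀ a : State N, a.1.1 = n → a = e₁ ∨ a = e₂ := by
    intro a ha
    rcases a.label_eq with h | h
    · exact Or.inl (State.ext_iff'.2 ⟨ha, h⟩)
    · exact Or.inr (State.ext_iff'.2 ⟨ha, h⟩)
  have hall : ∀ a b : State N, a.1.1 = n → b.1.1 = n →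
      single a b (1 : ℝ) * raise N (tailCoupling n d) ∈ M := by
    intro a b ha hb
    by_cases hab : a = b
    swap
    · exact hne a b ha hb hab
    subst hab
    obtain ⟨c, hc, hac⟩ : ∃ c : State N, c.1.1 = n ∧ a ≠ c := by
      rcases hcases a ha with rfl | rfl
      exacts [⟨e₂, rfl, he⟩, ⟨e₁, rfl, he.symm⟩]
    -- The diagonal unit at `a` need not lie in `M`; the detour through the other state `c` of the
    -- level has the same effect.
    have := M.lie_mem (hn a c hac ha.le hc.le) (hne c a hc ha hac.symm)
    rwa [Ring.lie_def, ← mul_assoc, single_mul_single_same, one_mul, mul_assoc (single c a _),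
      raise_tailCoupling_mul_single d ha.le, mul_zero, sub_zero] at this
  intro a t ha ht
  have r1 : single a (mkState n 1 hn1 hnN' le_rfl h1β) (1 : ℝ) * raise N (tailCoupling n d) ∈ M :=
    hall a e₁ ha rfl
  have r2 : single a (mkState n 2 hn1 hnN' one_le_two hβ.ge) (1 : ℝ) *
    raise N (tailCoupling n d) ∈ M := hall a e₂ ha rfl
  rw [single_mul_raise_tailCoupling d hn1 hnN rfl] at r1 r2
  change d n 1 1 • single a _ (1 : ℝ) + d n 1 2 • single a _ (1 : ℝ) ∈ M at r1
  change d n 2 1 • single a _ (1 : ℝ) + d n 2 2 • single a _ (1 : ℝ) ∈ M at r2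
  have hδ := sub_ne_zero.2 hdet
  rcases t.label_eq with h | h
  · obtain rfl : t = mkState (n + 1) 1 (Nat.le_add_left 1 n) hnN le_rfl (one_le_two.trans hβ') :=
      State.ext_iff'.2 ⟨ht, h⟩
    have := M.smul_mem (d n 1 1 * d n 2 2 - d n 1 2 * d n 2 1)⁻¹
      (sub_mem (M.smul_mem (d n 2 2) r1) (M.smul_mem (d n 1 2) r2))
    convert! this using 1
    rw [eq_inv_smul_iff₀ hδ]
    module
  · obtain rfl : t = mkState (n + 1) 2 (Nat.le_add_left 1 n) hnN one_le_two hβ' :=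
      State.ext_iff'.2 ⟨ht, h⟩
    have := M.smul_mem (d n 1 1 * d n 2 2 - d n 1 2 * d n 2 1)⁻¹
      (sub_mem (M.smul_mem (d n 1 1) r2) (M.smul_mem (d n 2 1) r1))
    convert! this using 1
    rw [eq_inv_smul_iff₀ hδ]
    module

/-- The coefficients of `x |1,1⟩⟨2,1| + y |1,1⟩⟨2,2|`. -/
def rowCoupling (v : Fin 2 → ℝ) : ℕ → ℕ → ℕ → ℝ :=
  fun n _ p => if n = 1 then (if p = 1 then v 0 else v 1) else 0

theorem raise_eq_row {W : ℕ → ℕ → ℕ → ℝ}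
    (h : ∀ i, 2 ≤ i → i ≤ N - 1 → block i W = 0) :
    raise N W = raise N (rowCoupling (firstBlock W)) := by
  refine raise_congr fun n j p h1 h2 h3 h4 h5 h6 => ?_
  have hp : p = 1 ∨ p = 2 := by omega
  by_cases hn : n = 1
  · subst hn
    rw [β_one] at h4
    obtain rfl : j = 1 := by omega
    rcases hp with rfl | rfl <;> simp [rowCoupling, firstBlock_apply]
  · have hb := h n (by omega) h2
    have := β_le_two n
    have hj : j = 1 ∨ j = 2 := by omega
    rw [block_apply] at hb
    simp only [rowCoupling, if_neg hn]
    rcases hj with rfl | rfl <;> rcases hp with rfl | rfl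
    exacts [congrFun hb 0, congrFun hb 1, congrFun hb 2, congrFun hb 3]

theorem raise_row (hN : 3 ≤ N) (v : Fin 2 → ℝ) :
    raise N (rowCoupling v) =
      v 0 • single (mkState 1 1 le_rfl (by omega) le_rfl le_rfl)
        (mkState 2 1 (by norm_num) (by omega) le_rfl (by norm_num [β])) (1 : ℝ) +
      v 1 • single (mkState 1 1 le_rfl (by omega) le_rfl le_rfl)
        (mkState 2 2 (by norm_num) (by omega) (by norm_num) (by norm_num [β])) (1 : ℝ) := by
  ext s t
  rw [Matrix.add_apply, Matrix.smul_apply, Matrix.smul_apply, raise_apply]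
  simp only [single_apply, State.ext_iff', mkState, rowCoupling]
  by_cases hs : s.1.1 = 1
  · have := State.label_eq_one hs
    rcases t.label_eq with h | h <;> by_cases ht : t.1.1 = 2 <;> simp [h, ht, hs, this, eq_comm]
  · simp [hs, Ne.symm hs]

theorem row_mul_row (hN : 3 ≤ N) (v w : Fin 2 → ℝ) :
    raise N (rowCoupling v) * raise N (rowCoupling w) = 0 := by
  rw [raise_row hN, raise_row hN]
  simp [add_mul, mul_add, mkState, single_mul_single_of_ne]

theorem row_mul_row_transpose (hN : 3 ≤ N) (u v w : Fin 2 → ℝ) :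
    raise N (rowCoupling u) * (raise N (rowCoupling v))ᵀ * raise N (rowCoupling w) =
      (u ⬝ᵥ v) • raise N (rowCoupling w) := by
  have hne : (mkState 2 1 (by norm_num) (by omega) le_rfl (by norm_num [β]) : State N) ≠
      mkState 2 2 (by norm_num) (by omega) (by norm_num) (by norm_num [β]) := fun h => by
    simpa [mkState] using (State.ext_iff'.1 h).2
  rw [raise_row hN, raise_row hN, raise_row hN, transpose_add, transpose_smul, transpose_smul,
    transpose_single, transpose_single]
  simp only [add_mul, mul_add, smul_mul_assoc, mul_smul_comm, single_mul_single_same,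
    single_mul_single_of_ne _ _ _ _ hne, single_mul_single_of_ne _ _ _ _ hne.symm,
    smul_zero, add_zero, zero_add, mul_one]
  simp only [dotProduct, Fin.sum_univ_two]
  module

theorem raise_eq_row_add_tail (d : ℕ → ℕ → ℕ → ℝ) :
    raise N d = raise N (rowCoupling (firstBlock d)) + raise N (tailCoupling 2 d) := by
  rw [← map_add]
  refine raise_congr fun n j p h1 h2 h3 h4 h5 h6 => ?_
  simp only [Pi.add_apply, rowCoupling, tailCoupling]
  by_cases hn : n = 1
  · subst hn
    rw [β_one] at h4
    obtain rfl : j = 1 := by omega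
    have hp : p = 1 ∨ p = 2 := by omega
    rcases hp with rfl | rfl <;> simp [firstBlock_apply]
  · rw [if_neg hn, if_pos (by omega), zero_add]

theorem tail_mul_row_transpose (hN : 3 ≤ N) (d : ℕ → ℕ → ℕ → ℝ) (v : Fin 2 → ℝ) :
    raise N (tailCoupling 2 d) * (raise N (rowCoupling v))ᵀ = 0 := by
  rw [raise_row hN, transpose_add, transpose_smul, transpose_smul, transpose_single,
    transpose_single, mul_add, mul_smul_comm, mul_smul_comm,
    raise_tailCoupling_mul_single d (by exact le_rfl),
    raise_tailCoupling_mul_single d (by exact le_rfl)]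
  simp

theorem row_transpose_mul_tail (hN : 3 ≤ N) (d : ℕ → ℕ → ℕ → ℝ) (v : Fin 2 → ℝ) :
    (raise N (rowCoupling v))ᵀ * raise N (tailCoupling 2 d) = 0 := by
  have h (a : State N) : single a (mkState 1 1 le_rfl (by omega) le_rfl le_rfl) (1 : ℝ) *
      raise N (tailCoupling 2 d) = 0 := by
    ext s t
    rw [Matrix.mul_apply, Matrix.zero_apply]
    refine Finset.sum_eq_zero fun u _ => ?_
    rw [single_apply]
    split_ifs with h
    · rw [raise_apply, tailCoupling, ← h.2]
      simp [mkState]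
    · rw [zero_mul]
  rw [raise_row hN, transpose_add, transpose_smul, transpose_smul, transpose_single,
    transpose_single, add_mul, smul_mul_assoc, smul_mul_assoc, h, h]
  simp

/-- The tail of `X` is annihilated by the transposed row on both sides, and products of two rows
vanish. What survives returns the first row of `X` from any nonzero row `v`, up to a multiple of `v`
itself. -/
theorem lie_row_lie_raise (hN : 3 ≤ N) (d : ℕ → ℕ → ℕ → ℝ) (v : Fin 2 → ℝ) :
    ⁅raise N (rowCoupling v), ⁅raise N d, (raise N (rowCoupling v))ᵀ⁆⁆ =
      -((v ⬝ᵥ v) • raise N (rowCoupling (firstBlock d))) -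
        (firstBlock d ⬝ᵥ v) • raise N (rowCoupling v) := by
  rw [raise_eq_row_add_tail d, ← row_mul_row_transpose hN, ← row_mul_row_transpose hN,
    Ring.lie_def, Ring.lie_def, add_mul, mul_add, tail_mul_row_transpose hN,
    row_transpose_mul_tail hN, mul_sub, sub_mul]
  simp only [add_zero, ← mul_assoc, row_mul_row hN, zero_mul, zero_sub]
  rw [mul_assoc _ (raise N (rowCoupling (firstBlock d))) (raise N (rowCoupling v)), row_mul_row hN]
  simp

theorem row_mem_of_row_mem (hN : 3 ≤ N) (hT : ∀ A ∈ M, Aᵀ ∈ M) {d : ℕ → ℕ → ℕ → ℝ}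
    (hX : raise N d ∈ M) {v : Fin 2 → ℝ} (hv : v ≠ 0) (h : raise N (rowCoupling v) ∈ M) :
    raise N (rowCoupling (firstBlock d)) ∈ M := by
  have hvv : v ⬝ᵥ v ≠ 0 := by
    rwa [Ne, dotProduct_self_eq_zero]
  have h1 := M.lie_mem h (M.lie_mem hX (hT _ h))
  rw [lie_row_lie_raise hN] at h1
  have h2 := M.smul_mem (-(v ⬝ᵥ v)⁻¹) (add_mem h1 (M.smul_mem (firstBlock d ⬝ᵥ v) h))
  rwa [sub_add_cancel, smul_neg, neg_smul, neg_neg, smul_smul, inv_mul_cancel₀ hvv, one_smul] at h2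

theorem raise_recursion_mem (hN : 3 ≤ N) (hT : ∀ A ∈ M, Aᵀ ∈ M) {d : ℕ → ℕ → ℕ → ℝ}
    (hX : raise N d ∈ M) {W : ℕ → ℕ → ℕ → ℝ} (hW : raise N W ∈ M) :
    raise N (recursion N d W) ∈ M := by
  rw [← lie_raise_levelOp, ← lie_raise_transpose hN]
  exact M.lie_mem hW (M.lie_mem hX (hT _ hX))

/-- The recursion keeps a row a row and acts on it by `G₁`. So `M` contains the rows `d` and `G₁ d`;
`hind` says that they are linearly independent. -/
theorem containsUnits_two (hN : 3 ≤ N) (hT : ∀ A ∈ M, Aᵀ ∈ M) {d : ℕ → ℕ → ℕ → ℝ}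
    (hX : raise N d ∈ M) {v : Fin 2 → ℝ} (hv : v ≠ 0) (h : raise N (rowCoupling v) ∈ M)
    (hind : d 1 1 1 * (G₁ N d *ᵥ firstBlock d) 1 ≠ d 1 1 2 * (G₁ N d *ᵥ firstBlock d) 0) :
    ContainsUnits M 2 := by
  have r1 := row_mem_of_row_mem hN hT hX hv h
  have r2 := raise_recursion_mem hN hT hX r1
  have hfb (w : Fin 2 → ℝ) : firstBlock (rowCoupling w) = w := by
    funext k
    fin_cases k <;> rfl
  rw [raise_eq_row (by
    intro i hi _
    rw [block_recursion d _ hi]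
    have : block i (rowCoupling (firstBlock d)) = 0 := by
      funext k
      have : i ≠ 1 := by omega
      fin_cases k <;> simp [block_apply, rowCoupling, this]
    rw [this, mulVec_zero]), firstBlock_recursion, hfb] at r2
  set w := G₁ N d *ᵥ firstBlock d with hw
  rw [raise_row hN] at r1 r2
  change d 1 1 1 • _ + d 1 1 2 • _ ∈ M at r1
  refine (containsUnits_one M).succ hT le_rfl (by omega) fun a t ha ht => ?_
  have h1N : 1 ≤ N := by omega
  rw [show a = mkState 1 1 le_rfl h1N le_rfl le_rfl from
    State.ext_iff'.2 ⟨ha, State.label_eq_one ha⟩]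
  have hδ := sub_ne_zero.2 hind
  rcases t.label_eq with h | h
  · have := M.smul_mem (d 1 1 1 * w 1 - d 1 1 2 * w 0)⁻¹
      (sub_mem (M.smul_mem (w 1) r1) (M.smul_mem (d 1 1 2) r2))
    convert! this using 1
    rw [eq_inv_smul_iff₀ hδ, show t = mkState 2 1 (by norm_num) (by omega) le_rfl
      (by norm_num [β]) from State.ext_iff'.2 ⟨ht, h⟩]
    module
  · have := M.smul_mem (d 1 1 1 * w 1 - d 1 1 2 * w 0)⁻¹
      (sub_mem (M.smul_mem (d 1 1 1) r2) (M.smul_mem (w 0) r1))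
    convert! this using 1
    rw [eq_inv_smul_iff₀ hδ, show t = mkState 2 2 (by norm_num) (by omega) (by norm_num)
      (by norm_num [β]) from State.ext_iff'.2 ⟨ht, h⟩]
    module

/-- A real Lie algebra closed under transposition that contains the raising operator contains all
matrix units if an eigenvalue of `G₁` is not an eigenvalue of the other recursion matrices. -/
theorem containsUnits_of_separated (hN : 3 ≤ N) (hT : ∀ A ∈ M, Aᵀ ∈ M) {d : ℕ → ℕ → ℕ → ℝ}
    (hX : raise N d ∈ M)
    (hdet : ∀ n, 2 ≤ n → n ≤ N - 1 → d n 1 1 * d n 2 2 ≠ d n 1 2 * d n 2 1)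
    (hind : d 1 1 1 * (G₁ N d *ᵥ firstBlock d) 1 ≠ d 1 1 2 * (G₁ N d *ᵥ firstBlock d) 0)
    {l : ℝ} (hl : (G₁ N d).charpoly.eval l = 0)
    (hl' : ∀ i, 2 ≤ i → i ≤ N - 1 → (G N d i).charpoly.eval l ≠ 0) :
    ContainsUnits M N := by
  -- `Q` kills every block above the first by Cayley–Hamilton, and does not vanish at `l`.
  set Q : Polynomial ℝ := ∏ i ∈ Finset.Icc 2 (N - 1), (G N d i).charpoly with hQ
  have hQl : Q.eval l ≠ 0 := by
    rw [hQ, Polynomial.eval_prod, Finset.prod_ne_zero_iff]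
    intro i hi
    rw [Finset.mem_Icc] at hi
    exact hl' i hi.1 hi.2
  have hQG : ∀ i, 2 ≤ i → i ≤ N - 1 → Polynomial.aeval (G N d i) Q = 0 := by
    intro i h1 h2
    rw [hQ, ← Finset.mul_prod_erase _ _ (Finset.mem_Icc.2 ⟨h1, h2⟩), map_mul,
      aeval_self_charpoly, zero_mul]
  set W := Polynomial.aeval (recursion N d) Q d with hW
  have hWM : raise N W ∈ M :=
    aeval_mem_of_invariant (recursion N d) (M.toSubmodule.comap (raise N))
      (fun v hv => raise_recursion_mem hN hT hX hv) Q hX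
  have hblock : ∀ i, 2 ≤ i → i ≤ N - 1 → block i W = 0 := by
    intro i h1 h2
    rw [hW, aeval_semiconj _ _ _ (fun v => block_recursion d v h1), hQG i h1 h2, zero_mulVec]
  have hfirst : firstBlock W = Polynomial.aeval (G₁ N d) Q *ᵥ firstBlock d := by
    rw [hW, aeval_semiconj _ _ _ (fun v => firstBlock_recursion d v)]
  rw [raise_eq_row hblock] at hWM
  have hne : firstBlock W ≠ 0 := by
    intro h0
    rw [hfirst] at h0
    set A := Polynomial.aeval (G₁ N d) Q with hA
    have hcomm : A * G₁ N d = G₁ N d * A := by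
      have := congrArg (Polynomial.aeval (G₁ N d)) (mul_comm Q Polynomial.X)
      rwa [map_mul, map_mul, Polynomial.aeval_X] at this
    have h0' : A *ᵥ (G₁ N d *ᵥ firstBlock d) = 0 := by
      rw [mulVec_mulVec, hcomm, ← mulVec_mulVec, h0, mulVec_zero]
    -- `A = Q(G₁)` kills `d`, and also `G₁ d` since it commutes with `G₁`; these two vectors span
    -- the plane. Spectral mapping then puts the nonzero number `Q(l)` in the spectrum of 0.
    have hA0 : A = 0 := by
      have hδ := sub_ne_zero.2 hind
      ext i j
      have e1 : A i 0 * d 1 1 1 + A i 1 * d 1 1 2 = 0 := by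
        simpa [mulVec, dotProduct, firstBlock_apply] using congrFun h0 i
      have e2 : A i 0 * (G₁ N d *ᵥ firstBlock d) 0 + A i 1 * (G₁ N d *ᵥ firstBlock d) 1 = 0 := by
        have := congrFun h0' i
        rwa [mulVec, dotProduct, Fin.sum_univ_two] at this
      have c0 : A i 0 = 0 := by
        refine (mul_eq_zero.1 ?_).resolve_right hδ
        linear_combination (G₁ N d *ᵥ firstBlock d) 1 * e1 - d 1 1 2 * e2
      have c1 : A i 1 = 0 := by
        refine (mul_eq_zero.1 ?_).resolve_right hδ
        linear_combination d 1 1 1 * e2 - (G₁ N d *ᵥ firstBlock d) 0 * e1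
      fin_cases j
      exacts [c0, c1]
    rw [eval_charpoly] at hl
    have hspec : l ∈ spectrum ℝ (G₁ N d) := by
      rw [spectrum.mem_iff, isUnit_iff_isUnit_det, isUnit_iff_ne_zero, not_not]
      exact hl
    have := spectrum.subset_polynomial_aeval (G₁ N d) Q ⟨l, hspec, rfl⟩
    rw [← hA, hA0, spectrum.zero_eq] at this
    exact hQl this
  have h2 := containsUnits_two hN hT hX hne hWM hind
  have : ∀ n, 2 ≤ n → n ≤ N → ContainsUnits M n := by
    intro n hn
    induction n, hn using Nat.le_induction with
    | base => exact fun _ => h2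
    | succ n hn ih =>
      intro hnN
      exact (ih (by omega)).succ_of_det_ne_zero hT hX hn (by omega) (hdet n hn (by omega))
  exact this N (by omega) le_rfl

end Generation

/-! ### The controllability criterion. -/

section Criterion

open Matrix

variable {N : ℕ}

theorem isHermitian_H₀ (N : ℕ) (E : ℕ → ℝ) : (H₀ N E).IsHermitian := by
  rw [IsHermitian, H₀, diagonal_conjTranspose]
  congr 1
  funext s
  simp

theorem H_I_eq_complexify (N : ℕ) (d : ℕ → ℕ → ℕ → ℝ) :
    H_I N d = complexify (raise N d + (raise N d)ᵀ) := by
  ext s t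
  rw [H_I, of_apply, complexify_apply, Matrix.add_apply, transpose_apply, raise_apply, raise_apply]
  split_ifs with h1 h2
  · omega
  all_goals simp

theorem isHermitian_complexify {ι : Type*} [Fintype ι] [DecidableEq ι] {R : Matrix ι ι ℝ}
    (hR : Rᵀ = R) : (complexify R).IsHermitian := by
  ext i j
  rw [conjTranspose_apply, complexify_apply, complexify_apply, ← congrFun (congrFun hR i) j]
  simp

theorem isHermitian_H_I (N : ℕ) (d : ℕ → ℕ → ℕ → ℝ) : (H_I N d).IsHermitian := by
  rw [H_I_eq_complexify]
  refine isHermitian_complexify ?_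
  rw [transpose_add, transpose_transpose, add_comm]

/-- With equal spacing, `[H₀, X + Xᵀ] = -μ (X - Xᵀ)`; dividing by `μ` separates `X` from its
transpose. -/
theorem raise_mem_realForm {E : ℕ → ℝ} {d : ℕ → ℕ → ℕ → ℝ} {μ : ℝ} (hμ : μ ≠ 0)
    (hE : ∀ n, 1 ≤ n → n ≤ N - 1 → E (n + 1) - E n = μ) :
    raise N d ∈ realForm (L₀ (H₀ N E) (H_I N d)) := by
  set M := realForm (L₀ (H₀ N E) (H_I N d)) with hM
  have h0 : (diagonal fun s : State N => E s.1.1) ∈ M := by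
    refine symm_mem_realForm (diagonal_transpose _) ?_
    have : complexify (diagonal fun s : State N => E s.1.1) = H₀ N E := by
      ext s t
      rw [complexify_apply, H₀, diagonal_apply, diagonal_apply]
      split_ifs <;> simp
    rw [this]
    exact LieSubalgebra.subset_lieSpan (by simp)
  have hI : raise N d + (raise N d)ᵀ ∈ M := by
    refine symm_mem_realForm (by rw [transpose_add, transpose_transpose, add_comm]) ?_
    rw [← H_I_eq_complexify]
    exact LieSubalgebra.subset_lieSpan (by simp)
  have hlie : ⁅diagonal fun s : State N => E s.1.1, raise N d + (raise N d)ᵀ⁆ =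
      -(μ • (raise N d - (raise N d)ᵀ)) := by
    ext s t
    rw [Ring.lie_def, Matrix.sub_apply, diagonal_mul, mul_diagonal, Matrix.neg_apply,
      Matrix.smul_apply, Matrix.sub_apply, Matrix.add_apply, transpose_apply, raise_apply,
      raise_apply, smul_eq_mul]
    have hs := s.bounds
    have ht := t.bounds
    split_ifs with h1 h2 h2
    · omega
    · have := hE s.1.1 hs.1 (by omega)
      rw [← h1] at this
      rw [← this]
      ring
    · have := hE t.1.1 ht.1 (by omega)
      rw [← h2] at this
      rw [← this]
      ring
    · simp
  have h1 := M.lie_mem h0 hI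
  rw [hlie] at h1
  have h2 := M.smul_mem (1 / 2 : ℝ) (sub_mem hI (M.smul_mem μ⁻¹ h1))
  convert! h2 using 1
  rw [smul_neg, inv_smul_smul₀ hμ]
  module

/-- Controllability of the degenerate system if an eigenvalue of `G₁` is not an eigenvalue of the
other recursion matrices. -/
theorem controllable_of_separated (hN : 3 ≤ N) {E : ℕ → ℝ} {d : ℕ → ℕ → ℕ → ℝ} {μ : ℝ}
    (hμ : μ ≠ 0) (hE : ∀ n, 1 ≤ n → n ≤ N - 1 → E (n + 1) - E n = μ)
    (hdet : ∀ n, 2 ≤ n → n ≤ N - 1 → d n 1 1 * d n 2 2 ≠ d n 1 2 * d n 2 1)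
    (hind : d 1 1 1 * (G₁ N d *ᵥ firstBlock d) 1 ≠ d 1 1 2 * (G₁ N d *ᵥ firstBlock d) 0)
    {l : ℝ} (hl : (G₁ N d).charpoly.eval l = 0)
    (hl' : ∀ i, 2 ≤ i → i ≤ N - 1 → (G N d i).charpoly.eval l ≠ 0) :
    su (State N) ≤ L₀ (H₀ N E) (H_I N d) ∧ CompletelyControllable (H₀ N E) (H_I N d) := by
  have hunits := containsUnits_of_separated hN (M := realForm (L₀ (H₀ N E) (H_I N d)))
    (fun _ => transpose_mem_realForm) (raise_mem_realForm hμ hE) hdet hind hl hl'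
  have hsu : su (State N) ≤ L₀ (H₀ N E) (H_I N d) := su_le_of_realForm fun R hR =>
    mem_of_single_mem (fun s t hst => hunits s t hst s.bounds.2.1 t.bounds.2.1) hR
  have : Nonempty (State N) := ⟨mkState 1 1 le_rfl (by omega) le_rfl le_rfl⟩
  exact ⟨hsu, completelyControllable_of_su_le (isHermitian_H₀ N E) (isHermitian_H_I N d) hsu⟩

theorem Diagonalizes.eval_charpoly {m : ℕ} {U : Matrix (Fin m) (Fin m) ℂ}
    {A : Matrix (Fin m) (Fin m) ℝ} {v : Fin m → ℝ} (h : Diagonalizes U A v) (l : ℝ) :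
    A.charpoly.eval l = ∏ k, (l - v k) := by
  obtain ⟨hU, hd⟩ := h
  have hUU : U * U⁻¹ = 1 := by
    refine mul_nonsing_inv _ ?_
    exact (isUnit_iff_isUnit_det _).1 (IsUnit.of_mul_eq_one _ (mem_unitaryGroup_iff.1 hU))
  have hdet : U.det * U⁻¹.det = 1 := by rw [← det_mul, hUU, det_one]
  have e : U * (scalar (Fin m) l - A).map (fun x : ℝ => (x : ℂ)) * U⁻¹ =
      diagonal fun k => ((l - v k : ℝ) : ℂ) := by
    have h1 : (scalar (Fin m) l - A).map (fun x : ℝ => (x : ℂ)) =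
        (l : ℂ) • (1 : Matrix (Fin m) (Fin m) ℂ) - A.map (fun x : ℝ => (x : ℂ)) := by
      ext i j
      by_cases hij : i = j <;> simp [hij, one_apply]
    rw [h1, mul_sub, sub_mul, hd, mul_smul_comm, smul_mul_assoc, mul_one, hUU]
    ext i j
    by_cases hij : i = j <;> simp [hij, one_apply]
  have h2 := congrArg det e
  rw [det_mul, det_mul, mul_right_comm, hdet, one_mul, det_diagonal] at h2
  have h3 : ((scalar (Fin m) l - A).map (fun x : ℝ => (x : ℂ))).det =
      (((scalar (Fin m) l - A).det : ℝ) : ℂ) :=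
    (RingHom.map_det Complex.ofRealHom _).symm
  rw [h3] at h2
  rw [Matrix.eval_charpoly]
  exact_mod_cast h2

theorem Diagonalizes.mulVec_mulVec {m : ℕ} {U : Matrix (Fin m) (Fin m) ℂ}
    {A : Matrix (Fin m) (Fin m) ℝ} {v : Fin m → ℝ} (h : Diagonalizes U A v) (x : Fin m → ℂ)
    (k : Fin m) :
    (U *ᵥ (A.map (fun x : ℝ => (x : ℂ)) *ᵥ x)) k = v k * (U *ᵥ x) k := by
  obtain ⟨hU, hd⟩ := h
  have hUU : U⁻¹ * U = 1 := by
    refine nonsing_inv_mul _ ?_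
    exact (isUnit_iff_isUnit_det _).1 (IsUnit.of_mul_eq_one _ (mem_unitaryGroup_iff.1 hU))
  rw [Matrix.mulVec_mulVec, ← mul_one (U * _), ← hUU, ← mul_assoc, hd, ← Matrix.mulVec_mulVec,
    mulVec_diagonal]

/-- In the eigenbasis `d` and `G₁ d` have coordinates `C_k` and `λ_k C_k`, whose determinant is `C_0
C_1 (λ_1 - λ_0)`. Linear dependence would make it vanish. -/
theorem cyclic_of_diagonalizes {d : ℕ → ℕ → ℕ → ℝ} {U₁ : Matrix (Fin 2) (Fin 2) ℂ}
    {v : Fin 2 → ℝ} (h : Diagonalizes U₁ (G₁ N d) v) (hv : v 0 ≠ v 1) (h0 : C₁ U₁ d 0 ≠ 0)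
    (h1 : C₁ U₁ d 1 ≠ 0) :
    d 1 1 1 * (G₁ N d *ᵥ firstBlock d) 1 ≠ d 1 1 2 * (G₁ N d *ᵥ firstBlock d) 0 := by
  intro heq
  set w := G₁ N d *ᵥ firstBlock d with hw
  have hx (k : Fin 2) : ((G₁ N d).map (fun x : ℝ => (x : ℂ)) *ᵥ
      ![(d 1 1 1 : ℂ), (d 1 1 2 : ℂ)]) k = (w k : ℂ) := by
    rw [hw]
    simp [mulVec, dotProduct, Fin.sum_univ_two, firstBlock_apply]
  have hk (k : Fin 2) : U₁ k 0 * w 0 + U₁ k 1 * w 1 = v k * C₁ U₁ d k := by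
    have := h.mulVec_mulVec ![(d 1 1 1 : ℂ), (d 1 1 2 : ℂ)] k
    rw [mulVec, dotProduct, Fin.sum_univ_two, hx, hx] at this
    exact this
  have hc (k : Fin 2) : C₁ U₁ d k = U₁ k 0 * d 1 1 1 + U₁ k 1 * d 1 1 2 := by
    simp [C₁, mulVec, dotProduct, Fin.sum_univ_two]
  have heq' : (d 1 1 1 : ℂ) * w 1 = d 1 1 2 * w 0 := by exact_mod_cast heq
  have key : C₁ U₁ d 0 * C₁ U₁ d 1 * ((v 0 : ℂ) - v 1) = 0 := by
    linear_combination -C₁ U₁ d 1 * hk 0 + C₁ U₁ d 0 * hk 1 +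
      (U₁ 0 0 * w 0 + U₁ 0 1 * w 1) * hc 1 - (U₁ 1 0 * w 0 + U₁ 1 1 * w 1) * hc 0
      - (U₁ 0 0 * U₁ 1 1 - U₁ 0 1 * U₁ 1 0) * heq'
  have hv' : (v 0 : ℂ) - v 1 ≠ 0 := by
    rw [sub_ne_zero]
    exact_mod_cast hv
  exact mul_ne_zero (mul_ne_zero h0 h1) hv' key

end Criterion

/-! ### The square-root couplings. -/

section Example

open Matrix

variable {N : ℕ}

/-- The quadratic form of the `n`-th block of `[X, Xᵀ]`. -/
noncomputable def levelForm (N : ℕ) (d : ℕ → ℕ → ℕ → ℝ) (n : ℕ) (x y : ℝ) : ℝ :=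
  Ksq N d n 1 * x ^ 2 + Ksq N d n 2 * y ^ 2 - 2 * b N d (n - 1) * x * y

/-- Read a vector as a 2×2 matrix. The form of `G_i` is that of level `i + 1` on its rows minus that
of level `i` on its columns, so every eigenvalue is at least `p - q`. -/
theorem eval_charpoly_G_ne_zero {d : ℕ → ℕ → ℕ → ℝ} {i : ℕ} {l p q : ℝ} (hl : l < p - q)
    (hp : ∀ x y, p * (x ^ 2 + y ^ 2) ≤ levelForm N d (i + 1) x y)
    (hq : ∀ x y, levelForm N d i x y ≤ q * (x ^ 2 + y ^ 2)) :
    (G N d i).charpoly.eval l ≠ 0 := by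
  intro h
  rw [eval_charpoly] at h
  obtain ⟨x, hx0, hx⟩ := exists_mulVec_eq_zero_iff.2 h
  have hx' : G N d i *ᵥ x = l • x := by
    rw [sub_mulVec, sub_eq_zero] at hx
    rw [← hx]
    funext k
    simp [mulVec_diagonal]
  have e : x ⬝ᵥ (G N d i *ᵥ x) = levelForm N d (i + 1) (x 0) (x 1) +
      levelForm N d (i + 1) (x 2) (x 3) - levelForm N d i (x 0) (x 2) -
      levelForm N d i (x 1) (x 3) := by
    simp [dotProduct, mulVec, Fin.sum_univ_four, G, ν, levelForm]
    ring
  rw [hx'] at e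
  have e' : x ⬝ᵥ (l • x) = l * (x 0 ^ 2 + x 1 ^ 2 + x 2 ^ 2 + x 3 ^ 2) := by
    simp [dotProduct, Fin.sum_univ_four]
    ring
  rw [e'] at e
  have hpos : 0 < x 0 ^ 2 + x 1 ^ 2 + x 2 ^ 2 + x 3 ^ 2 := by
    have := dotProduct_self_star_pos_iff.2 hx0
    simp only [dotProduct, Fin.sum_univ_four, star_trivial] at this
    linarith
  nlinarith [hp (x 0) (x 1), hp (x 2) (x 3), hq (x 0) (x 2), hq (x 1) (x 3)]

variable {d : ℕ → ℕ → ℕ → ℝ}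

/-- Below the top level both diagonal entries are -2 and the off-diagonal entry has size at most
5/2, so the bounds are `-2 ± 5/2`. At the top the eigenvalues are `-2 ± √3`, inside the same
interval. -/
theorem levelForm_bounds_of_sqrt (hd : ∀ i j k, d i j k = √((N : ℝ) + 3 - i - j - k)) {n : ℕ}
    (h3 : 3 ≤ n) (hn : n ≤ N) (x y : ℝ) :
    -(9 / 2) * (x ^ 2 + y ^ 2) ≤ levelForm N d n x y ∧
      levelForm N d n x y ≤ 1 / 2 * (x ^ 2 + y ^ 2) := by
  have hc1 : ((n - 1 : ℕ) : ℝ) = n - 1 := by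
    rw [Nat.cast_sub (by omega), Nat.cast_one]
  rcases hn.lt_or_eq with hlt | rfl
  · obtain ⟨r, hr⟩ : ∃ r : ℝ, r = N - n := ⟨_, rfl⟩
    have hr1 : 1 ≤ r := by
      have : (n : ℝ) + 1 ≤ N := by exact_mod_cast hlt
      linarith
    have d11 : d n 1 1 = √(r + 1) := by rw [hd, hr]; congr 1; push_cast; ring
    have d12 : d n 1 2 = √r := by rw [hd, hr]; congr 1; push_cast; ring
    have d21 : d n 2 1 = √r := by rw [hd, hr]; congr 1; push_cast; ring
    have d22 : d n 2 2 = √(r - 1) := by rw [hd, hr]; congr 1; push_cast; ring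
    have c11 : d (n - 1) 1 1 = √(r + 2) := by rw [hd, hr, hc1]; congr 1; push_cast; ring
    have c12 : d (n - 1) 1 2 = √(r + 1) := by rw [hd, hr, hc1]; congr 1; push_cast; ring
    have c21 : d (n - 1) 2 1 = √(r + 1) := by rw [hd, hr, hc1]; congr 1; push_cast; ring
    have c22 : d (n - 1) 2 2 = √r := by rw [hd, hr, hc1]; congr 1; push_cast; ring
    have s0 : √r ^ 2 = r := Real.sq_sqrt (by linarith)
    have s1 : √(r + 1) ^ 2 = r + 1 := Real.sq_sqrt (by linarith)
    have s2 : √(r + 2) ^ 2 = r + 2 := Real.sq_sqrt (by linarith)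
    have s3 : √(r - 1) ^ 2 = r - 1 := Real.sq_sqrt (by linarith)
    have k1 : Ksq N d n 1 = -2 := by
      rw [Ksq, if_neg (by omega), if_neg (by omega), β_of_two_le (by omega),
        β_of_two_le (by omega), sum_Icc_one_two, sum_Icc_one_two, d11, d12, c11, c21, s0, s1, s2]
      ring
    have k2 : Ksq N d n 2 = -2 := by
      rw [Ksq, if_neg (by omega), if_neg (by omega), β_of_two_le (by omega),
        β_of_two_le (by omega), sum_Icc_one_two, sum_Icc_one_two, d21, d22, c12, c22, s0, s1, s3]
      ring
    have hb : b N d (n - 1) = √(r + 2) * √(r + 1) - √r * √(r - 1) := by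
      rw [b, if_neg (by omega), if_neg (by omega), show n - 1 + 1 = n by omega, d11, d12, d21, d22,
        c11, c12, c21, c22]
      ring
    have u1 : √(r + 2) * √(r + 1) ≤ r + 3 / 2 := by nlinarith [sq_nonneg (√(r + 2) - √(r + 1))]
    have u2 : r - 1 ≤ √r * √(r - 1) := by
      have : √(r - 1) ≤ √r := Real.sqrt_le_sqrt (by linarith)
      nlinarith [Real.sqrt_nonneg (r - 1)]
    have u3 : √r * √(r - 1) ≤ √(r + 2) * √(r + 1) :=
      mul_le_mul (Real.sqrt_le_sqrt (by linarith)) (Real.sqrt_le_sqrt (by linarith))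
        (Real.sqrt_nonneg _) (Real.sqrt_nonneg _)
    rw [levelForm, k1, k2]
    have hb0 : 0 ≤ b N d (n - 1) := by rw [hb]; linarith
    have hb1 : b N d (n - 1) ≤ 5 / 2 := by rw [hb]; linarith
    constructor <;>
      nlinarith [mul_nonneg hb0 (sq_nonneg (x + y)), mul_nonneg hb0 (sq_nonneg (x - y)),
        mul_nonneg (sub_nonneg.2 hb1) (add_nonneg (sq_nonneg x) (sq_nonneg y))]
  · have c11 : d (n - 1) 1 1 = √2 := by rw [hd, hc1]; congr 1; push_cast; ring
    have c12 : d (n - 1) 1 2 = 1 := by rw [hd, hc1, Real.sqrt_eq_one]; push_cast; ring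
    have c21 : d (n - 1) 2 1 = 1 := by rw [hd, hc1, Real.sqrt_eq_one]; push_cast; ring
    have c22 : d (n - 1) 2 2 = 0 := by
      rw [hd, hc1, Real.sqrt_eq_zero']
      push_cast
      linarith
    have s2 : √(2 : ℝ) ^ 2 = 2 := Real.sq_sqrt (by norm_num)
    have k1 : Ksq n d n 1 = -3 := by
      rw [Ksq, if_neg (by omega), if_pos rfl, c11, c21, s2]
      norm_num
    have k2 : Ksq n d n 2 = -1 := by
      rw [Ksq, if_neg (by omega), if_pos rfl, c12, c22]
      norm_num
    have hb : b n d (n - 1) = √2 := by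
      rw [b, if_neg (by omega), if_pos rfl, c11, c12, c21, c22]
      ring
    rw [levelForm, k1, k2, hb]
    constructor
    · nlinarith [sq_nonneg (√2 * y - x), sq_nonneg x, sq_nonneg y]
    · nlinarith [sq_nonneg (√2 * x + y), sq_nonneg x, sq_nonneg y]

/-- The couplings `d_{ij,i+1 k} = (N + 3 - i - j - k)^{1/2}` satisfy the criterion. -/
theorem controllable_of_sqrt (hN : 3 ≤ N) {E : ℕ → ℝ} (hE : ∀ n : ℕ, E n = (n : ℝ) - 1 / 2)
    (hd : ∀ i j k, d i j k = √((N : ℝ) + 3 - i - j - k)) :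
    su (State N) ≤ L₀ (H₀ N E) (H_I N d) ∧ CompletelyControllable (H₀ N E) (H_I N d) := by
  obtain ⟨m, hm⟩ : ∃ m : ℝ, m = N - 2 := ⟨_, rfl⟩
  have hm1 : 1 ≤ m := by
    have : (3 : ℝ) ≤ N := by exact_mod_cast hN
    linarith
  have a1 : d 1 1 1 = √(m + 2) := by rw [hd, hm]; congr 1; push_cast; ring
  have a2 : d 1 1 2 = √(m + 1) := by rw [hd, hm]; congr 1; push_cast; ring
  have d11 : d 2 1 1 = √(m + 1) := by rw [hd, hm]; congr 1; push_cast; ring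
  have d12 : d 2 1 2 = √m := by rw [hd, hm]; congr 1; push_cast; ring
  have d21 : d 2 2 1 = √m := by rw [hd, hm]; congr 1; push_cast; ring
  have d22 : d 2 2 2 = √(m - 1) := by rw [hd, hm]; congr 1; push_cast; ring
  have s0 : √m ^ 2 = m := Real.sq_sqrt (by linarith)
  have s1 : √(m + 1) ^ 2 = m + 1 := Real.sq_sqrt (by linarith)
  have s2 : √(m + 2) ^ 2 = m + 2 := Real.sq_sqrt (by linarith)
  have s3 : √(m - 1) ^ 2 = m - 1 := Real.sq_sqrt (by linarith)
  have k0 : Ksq N d 1 1 = 2 * m + 3 := by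
    rw [Ksq, if_pos rfl, a1, a2, s1, s2]
    ring
  have k1 : Ksq N d 2 1 = m - 1 := by
    rw [Ksq, if_neg (by norm_num), if_neg (by omega), β_of_two_le (by norm_num), sum_Icc_one_two,
      show β (2 - 1) = 1 from rfl, Finset.Icc_self, Finset.sum_singleton, d11, d12, a1, s0, s1, s2]
    ring
  have k2 : Ksq N d 2 2 = m - 2 := by
    rw [Ksq, if_neg (by norm_num), if_neg (by omega), β_of_two_le (by norm_num), sum_Icc_one_two,
      show β (2 - 1) = 1 from rfl, Finset.Icc_self, Finset.sum_singleton, d21, d22, a2, s0, s1, s3]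
    ring
  have hb : b N d 1 = √(m + 2) * √(m + 1) - √(m + 1) * √m - √m * √(m - 1) := by
    rw [b, if_pos rfl, a1, a2, d11, d12, d21, d22]
  -- `G₁` has diagonal `-m - 4, -m - 5` and level 2 has diagonal `m - 1, m - 2`, both with
  -- off-diagonal entry `-b₁`. So `ρ` is half the eigenvalue gap of each, and `-m - 9/2 - ρ` is the
  -- smaller eigenvalue of `G₁`.
  set ρ := √(1 / 4 + b N d 1 ^ 2) with hρ
  have hρ2 : ρ ^ 2 = 1 / 4 + b N d 1 ^ 2 := Real.sq_sqrt (by positivity)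
  have hρ1 : 1 / 2 ≤ ρ := Real.le_sqrt_of_sq_le (by nlinarith [sq_nonneg (b N d 1)])
  refine controllable_of_separated hN one_ne_zero (fun n _ _ => ?_) (fun n h2 hn => ?_) ?_
    (l := -m - 9 / 2 - ρ) ?_ (fun i h2 hi => ?_)
  · rw [hE, hE]
    push_cast
    ring
  · obtain ⟨r, hr⟩ : ∃ r : ℝ, r = N - n := ⟨_, rfl⟩
    have hr1 : 1 ≤ r := by
      have : (n : ℝ) + 1 ≤ N := by exact_mod_cast (by omega : n + 1 ≤ N)
      linarith
    have e11 : d n 1 1 = √(r + 1) := by rw [hd, hr]; congr 1; push_cast; ring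
    have e12 : d n 1 2 = √r := by rw [hd, hr]; congr 1; push_cast; ring
    have e21 : d n 2 1 = √r := by rw [hd, hr]; congr 1; push_cast; ring
    have e22 : d n 2 2 = √(r - 1) := by rw [hd, hr]; congr 1; push_cast; ring
    rw [e11, e12, e21, e22]
    intro h
    -- Squared, the equation reads `(r + 1)(r - 1) = r²`.
    have h' := congrArg (· ^ 2) h
    simp only [mul_pow] at h'
    rw [Real.sq_sqrt (by linarith), Real.sq_sqrt (by linarith), Real.sq_sqrt (by linarith)] at h'
    linarith
  · have u1 : √(m + 1) * √m < √(m + 2) * √(m + 1) := by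
      rw [mul_comm]
      exact mul_lt_mul_of_pos_right (Real.sqrt_lt_sqrt (by linarith) (by linarith))
        (Real.sqrt_pos.2 (by linarith))
    have u2 : √m * √(m - 1) ≤ √(m + 2) * √(m + 1) :=
      mul_le_mul (Real.sqrt_le_sqrt (by linarith)) (Real.sqrt_le_sqrt (by linarith))
        (Real.sqrt_nonneg _) (Real.sqrt_nonneg _)
    -- Once `b₁` is expanded, `√(m + 2) √(m + 1)` occurs with coefficient -2, and `u1`, `u2` make
    -- the sum strictly negative.
    have e : d 1 1 1 * (G₁ N d *ᵥ firstBlock d) 1 - d 1 1 2 * (G₁ N d *ᵥ firstBlock d) 0 =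
        -b N d 1 - √(m + 2) * √(m + 1) := by
      simp only [G₁, ν, firstBlock_apply, mulVec, dotProduct, Fin.sum_univ_two, of_apply, cons_val,
        k0, k1, k2, a1, a2]
      linear_combination b N d 1 * s1 - b N d 1 * s2
    intro h
    rw [← sub_eq_zero, e, hb] at h
    linarith
  · rw [eval_charpoly, det_fin_two]
    simp [G₁, ν, k0, k1, k2]
    linear_combination hρ2
  · rcases h2.lt_or_eq with h3 | rfl
    · refine eval_charpoly_G_ne_zero (p := -(9 / 2)) (q := 1 / 2) (by linarith)
        (fun x y => (levelForm_bounds_of_sqrt hd (by omega) (by omega) x y).1)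
        (fun x y => (levelForm_bounds_of_sqrt hd h3 (by omega) x y).2)
    -- Level 2 lies outside the uniform bounds; `q` is the larger eigenvalue of its block, and `p -
    -- q` still exceeds `l` by 3/2.
    · refine eval_charpoly_G_ne_zero (p := -(9 / 2)) (q := m - 3 / 2 + ρ) (by linarith)
        (fun x y => (levelForm_bounds_of_sqrt hd (by omega) (by omega) x y).1) fun x y => ?_
      rw [levelForm, k1, k2]
      -- Completing the square: by `ρ² = 1/4 + b₁²`, this is `ρ + 1/2` times the difference of the
      -- two sides.
      have h := sq_nonneg ((ρ + 1 / 2) * y + b N d 1 * x)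
      have h' : 0 ≤ (ρ + 1 / 2) * ((ρ - 1 / 2) * x ^ 2 + 2 * b N d 1 * x * y +
          (ρ + 1 / 2) * y ^ 2) := by
        refine h.trans_eq ?_
        linear_combination -x ^ 2 * hρ2
      have h'' := nonneg_of_mul_nonneg_right h' (by linarith)
      change (m - 1) * x ^ 2 + (m - 2) * y ^ 2 - 2 * b N d 1 * x * y ≤ _
      linarith

end Example

end DegenerateControl

theorem theorem2 :
    (∀ (N : ℕ) (E : ℕ → ℝ) (d : ℕ → ℕ → ℕ → ℝ) (μ : ℝ)
        (U₁ : Matrix (Fin 2) (Fin 2) ℂ) (U : ℕ → Matrix (Fin 4) (Fin 4) ℂ) (lam : ℕ → ℕ → ℝ),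
      3 ≤ N →
      -- equally spaced levels
      μ ≠ 0 → (∀ n, 1 ≤ n → n ≤ N - 1 → E (n + 1) - E n = μ) →
      -- the determinant condition
      (∀ n, 2 ≤ n → n ≤ N - 1 → d n 1 1 * d n 2 2 ≠ d n 1 2 * d n 2 1) →
      -- `lam i j` are the eigenvalues of the recursion matrices
      DegenerateControl.Diagonalizes U₁ (DegenerateControl.G₁ N d) ![lam 1 1, lam 1 2] →
      (∀ i, 2 ≤ i → i ≤ N - 1 →
        DegenerateControl.Diagonalizes (U i) (DegenerateControl.G N d i)
          ![lam i 1, lam i 2, lam i 3, lam i 4]) →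
      -- the condition on `G₁` and on the transformed couplings
      lam 1 1 ≠ 0 → lam 1 2 ≠ 0 → lam 1 1 ≠ lam 1 2 →
      DegenerateControl.C₁ U₁ d 0 ≠ 0 → DegenerateControl.C₁ U₁ d 1 ≠ 0 →
      -- the non-zero eigenvalues of all the recursion matrices are pairwise distinct
      (∀ i j i' j', 1 ≤ i → i ≤ N - 1 → 1 ≤ j → j ≤ 2 * DegenerateControl.β i →
        1 ≤ i' → i' ≤ N - 1 → 1 ≤ j' → j' ≤ 2 * DegenerateControl.β i' →
        (i, j) ≠ (i', j') → lam i j ≠ 0 → lam i' j' ≠ 0 → lam i j ≠ lam i' j') →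
      DegenerateControl.su (DegenerateControl.State N) ≤
          DegenerateControl.L₀ (DegenerateControl.H₀ N E) (DegenerateControl.H_I N d) ∧
        DegenerateControl.CompletelyControllable
          (DegenerateControl.H₀ N E) (DegenerateControl.H_I N d)) ∧
    -- the explicit example
    (∀ (N : ℕ) (E : ℕ → ℝ) (d : ℕ → ℕ → ℕ → ℝ),
      3 ≤ N →
      (∀ n, E n = (n : ℝ) - 1 / 2) →
      (∀ i j k, d i j k = Real.sqrt ((N : ℝ) + 3 - i - j - k)) →
      DegenerateControl.su (DegenerateControl.State N) ≤
          DegenerateControl.L₀ (DegenerateControl.H₀ N E) (DegenerateControl.H_I N d) ∧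
        DegenerateControl.CompletelyControllable
          (DegenerateControl.H₀ N E) (DegenerateControl.H_I N d)) := by
  open DegenerateControl in
  refine ⟨?_, fun N E d hN hE hd => controllable_of_sqrt hN hE hd⟩
  intro N E d μ U₁ U lam hN hμ hE hdet hG₁ hG h11 _ hne hC0 hC1 hsep
  refine controllable_of_separated hN hμ hE hdet
    (cyclic_of_diagonalizes hG₁ hne hC0 hC1) (l := lam 1 1) ?_ fun i h2 hi => ?_
  · simp [hG₁.eval_charpoly, Fin.prod_univ_two]
  · have hβ := β_of_two_le h2
    -- Distinctness is assumed only among nonzero eigenvalues; a zero eigenvalue of `G_i` differs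
    -- from `lam 1 1` because the latter is nonzero.
    have hl : ∀ j, 1 ≤ j → j ≤ 4 → lam 1 1 - lam i j ≠ 0 := by
      intro j hj1 hj4
      rw [sub_ne_zero]
      by_cases h0 : lam i j = 0
      · rwa [h0]
      · refine hsep 1 1 i j le_rfl (by omega) le_rfl (by simp [β]) (by omega) hi hj1 (by omega) ?_
          h11 h0
        intro h
        have := congrArg Prod.fst h
        simp only at this
        omega
    rw [(hG i h2 hi).eval_charpoly, Finset.prod_ne_zero_iff]
    intro k _
    fin_cases k
    exacts [hl 1 (by norm_num) (by norm_num), hl 2 (by norm_num) (by norm_num),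
      hl 3 (by norm_num) (by norm_num), hl 4 (by norm_num) (by norm_num)]
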